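/- **Theorem 5.2.** *The model.* Let $\Omega\subset\mathbb R^2$ be a bounded Lipschitz domain (not necessarily connected), let $dS$ be arc length on $\partial\Omega$, and let $O_1,\dots,O_L\subset\partial\Omega$ be measurable sets of positive arc length. Let $F^{(1)},\dots,F^{(J)}\in\mathbb R^L$ be flux patterns. For bounded measurable $a,b:\Omega\to\mathbb R$ that are bounded below by a positive constant, a pair $(u,U)\in H^1(\Omega)\oplus\mathbb R^L$ is a weak solution for the flux $F\in\mathbb R^L$ if for all $(v,V)\in H^1(\Omega)\oplus\mathbb R^L$ $$\int_\Omega a\,\nabla u\cdot\nabla v\,dx+\int_\Omega b\,uv\,dx+\sum_{l=1}^L\frac12\int_{O_l}(u-U_l)(v-V_l)\,dS=-\sum_{l=1}^LF_lV_l ,$$ where $u,v$ are replaced by their traces in the boundary integrals. (This is the weak form of $-\nabla\cdot(a\nabla u)+bu=0$ in $\Omega$, $u+2a\,\partial_\nu u=U_l$ on $O_l$, $a\,\partial_\nu u=0$ on $\partial\Omega\setminus\bigcup_lO_l$, $\int_{O_l}-a\,\partial_\nu u\,dS=F_l$.) *The level-set maps.* Let $-\infty=c_0<c_1<\dots<c_M=\infty$,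 $-\infty=d_0<d_1<\dots<d_N=\infty$ and $a_1,\dots,a_M,b_1,\dots,b_N>0$. For $u_1,u_2\in C(\bar\Omega)$ put $$H_1(u_1)=\sum_{i=1}^Ma_i\,\mathbb 1_{\{x\in\Omega:\,c_{i-1}\le u_1(x)<c_i\}},\qquad H_2(u_2)=\sum_{i=1}^Nb_i\,\mathbb 1_{\{x\in\Omega:\,d_{i-1}\le u_2(x)<d_i\}} .$$ *The Bayesian problem.* Let $\Gamma_0\in\mathbb R^{L\times L}$ be symmetric positive definite, $\Gamma=\mathrm{diag}(\Gamma_0,\dots,\Gamma_0)$ ($J$ blocks), and $|y|_\Gamma=|\Gamma^{-1/2}y|$ for $y\in\mathbb R^{LJ}$. Let $\mu_1^0,\mu_2^0$ be Gaussian measures on $C(\bar\Omega)$ (with its Borel $\sigma$-algebra) and $\mu^0=\mu_1^0\times\mu_2^0$. *Conclusion.* (i) For all $u_1,u_2\in C(\bar\Omega)$ and all $j$ there is exactly one weak solution $(u^{(j)},U^{(j)})$ with coefficients $a=H_1(u_1)$, $b=H_2(u_2)$ and flux $F^{(j)}$, and the forward map $G(u_1,u_2)=(U^{(1)},\dots,U^{(J)})\in\mathbb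 R^{LJ}$ is measurable. Let $\Phi(u_1,u_2;y)=\frac12|y-G(u_1,u_2)|_\Gamma^2$ and $Z(y)=\int_{C(\bar\Omega)\times C(\bar\Omega)}\exp(-\Phi(u_1,u_2;y))\,\mu^0(du_1,du_2)$. Consider the data model $y=G(u_1,u_2)+\eta$ with $(u_1,u_2)\sim\mu^0$ and $\eta\sim N(0,\Gamma)$ independent of $(u_1,u_2)$. (ii) The posterior exists: there is a Markov kernel $y\mapsto\mu^y$ from $\mathbb R^{LJ}$ to $C(\bar\Omega)\times C(\bar\Omega)$ that is a regular conditional distribution of $(u_1,u_2)$ given $y$ and such that for every $y\in\mathbb R^{LJ}$ one has $Z(y)>0$, $\mu^y\ll\mu^0$ and $$\frac{d\mu^y}{d\mu^0}(u_1,u_2)=\frac1{Z(y)}\exp(-\Phi(u_1,u_2;y))\qquad\text{for }\mu^0\text{-a.e. }(u_1,u_2).$$ (iii) For every $\rho$ there is a constant $C(\rho)$ such that for all $y,y'\in\mathbb R^{LJ}$ with $|y|_\Gamma<\rho$ and $|y'|_\Gamma<\rho$ $$d_{\mathrm{Hell}}(\mu^y,\mu^{y'})\le C(\rho)\,|y-y'|_\Gamma,$$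 where $d_{\mathrm{Hell}}(p_1,p_2)^2=\frac12\int\Big(\sqrt{\tfrac{dp_1}{d\mu^0}}-\sqrt{\tfrac{dp_2}{d\mu^0}}\Big)^2d\mu^0$. -/

import Mathlib

open MeasureTheory ProbabilityTheory Filter Topology
open scoped ENNReal NNReal ContDiff MatrixOrder RealInnerProductSpace

noncomputable section

namespace LevelSetBayes

/-- The Euclidean plane. -/
abbrev Plane : Type := EuclideanSpace ℝ (Fin 2)

/-- `Ω` is a bounded Lipschitz domain (not necessarily connected): an open bounded set that, near
each of its boundary points and in suitable orthonormal coordinates, is the region strictly above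
the graph of a Lipschitz function. -/
structure IsLipschitzDomain (Ω : Set Plane) : Prop where
  isOpen : IsOpen Ω
  isBounded : Bornology.IsBounded Ω
  exists_graph : ∀ p ∈ frontier Ω, ∃ (T : Plane ≃ₗᵢ[ℝ] Plane) (K : ℝ≥0) (γ : ℝ → ℝ) (N : Set Plane),
    LipschitzWith K γ ∧ IsOpen N ∧ p ∈ N ∧ ∀ x ∈ N, x ∈ Ω ↔ γ (T x 0) < T x 1

/-- The surface measure `dS` on `∂Ω`: arc length, that is, the one-dimensional Hausdorff measure
restricted to the boundary. -/
def surfaceMeasure (Ω : Set Plane) : Measure Plane :=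
  (Measure.hausdorffMeasure 1 : Measure Plane).restrict (frontier Ω)

/-- `L²(Ω)`. -/
abbrev L2 (Ω : Set Plane) : Type := Lp ℝ 2 ((volume : Measure Plane).restrict Ω)

/-- `L²(Ω; ℝ²)`. -/
abbrev L2Vec (Ω : Set Plane) : Type := Lp Plane 2 ((volume : Measure Plane).restrict Ω)

/-- `L²(∂Ω)`. -/
abbrev L2Bdry (Ω : Set Plane) : Type := Lp ℝ 2 (surfaceMeasure Ω)

/-- `Du` is the weak gradient of `u` on `Ω`. Thus `u ∈ L²(Ω)` lies in `H¹(Ω)` if and only if it has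
a weak gradient in `L²(Ω; ℝ²)`. -/
def IsWeakGradient (Ω : Set Plane) (u : L2 Ω) (Du : L2Vec Ω) : Prop :=
  ∀ φ : Plane → ℝ, ContDiff ℝ ∞ φ → HasCompactSupport φ → tsupport φ ⊆ Ω →
    ∫ x in Ω, u x • gradient φ x = -∫ x in Ω, φ x • Du x

/-- `g ∈ L²(∂Ω)` is the boundary trace of the `H¹(Ω)` function `u` with weak gradient `Du`: there
are functions, smooth up to the boundary, that converge to `u` in `H¹(Ω)` and whose restrictions to
the boundary converge to `g` in `L²(∂Ω)`. (On a bounded Lipschitz domain every `H¹` function has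
exactly one trace in this sense.) -/
def IsTrace (Ω : Set Plane) (u : L2 Ω) (Du : L2Vec Ω) (g : L2Bdry Ω) : Prop :=
  ∃ φ : ℕ → Plane → ℝ, (∀ n, ContDiff ℝ ∞ (φ n)) ∧
    Tendsto (fun n => eLpNorm (fun x => φ n x - u x) 2 (volume.restrict Ω)) atTop (𝓝 0) ∧
    Tendsto (fun n => eLpNorm (fun x => gradient (φ n) x - Du x) 2 (volume.restrict Ω))
      atTop (𝓝 0) ∧
    Tendsto (fun n => eLpNorm (fun x => φ n x - g x) 2 (surfaceMeasure Ω)) atTop (𝓝 0)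

/-- The bilinear form
`B((u,U),(w,W)) = ∫_Ω a ∇u·∇w + ∫_Ω b u w + ∑_l ½ ∫_{O_l} (u - U_l)(w - W_l) dS`,
where `Du, Dw` are the weak gradients of `u, w`, and `g, h` are their boundary traces. -/
def bilinForm {L : ℕ} (Ω : Set Plane) (O : Fin L → Set Plane) (a b : Plane → ℝ)
    (u : L2 Ω) (Du : L2Vec Ω) (g : L2Bdry Ω) (U : EuclideanSpace ℝ (Fin L))
    (w : L2 Ω) (Dw : L2Vec Ω) (h : L2Bdry Ω) (W : EuclideanSpace ℝ (Fin L)) : ℝ :=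
  (∫ x in Ω, a x * ⟪Du x, Dw x⟫) + (∫ x in Ω, b x * (u x * w x)) +
    ∑ l, (1 / 2 : ℝ) * ∫ x in O l, (g x - U l) * (h x - W l) ∂(surfaceMeasure Ω)

/-- `(u, U) ∈ H¹(Ω) ⊕ ℝ^L` is a weak solution of the semi-discrete model with coefficients `a, b`,
boundary elements `O_l` and flux pattern `F`:
`B((u,U),(v,V)) = -∑_l F_l V_l` for all `(v,V) ∈ H¹(Ω) ⊕ ℝ^L`. -/
def IsWeakSolution {L : ℕ} (Ω : Set Plane) (O : Fin L → Set Plane) (a b : Plane → ℝ)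
    (F : EuclideanSpace ℝ (Fin L)) (p : L2 Ω × EuclideanSpace ℝ (Fin L)) : Prop :=
  ∃ (Du : L2Vec Ω) (g : L2Bdry Ω), IsWeakGradient Ω p.1 Du ∧ IsTrace Ω p.1 Du g ∧
    ∀ (v : L2 Ω) (Dv : L2Vec Ω) (h : L2Bdry Ω) (V : EuclideanSpace ℝ (Fin L)),
      IsWeakGradient Ω v Dv → IsTrace Ω v Dv h →
        bilinForm Ω O a b p.1 Du g p.2 v Dv h V = -∑ l, F l * V l

open Classical in
/-- The solution operator `ℳ : (a, b) ↦ (u, U)` for the flux pattern `F` (and `0` if there is no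
weak solution). -/
def solutionOperator {L : ℕ} (Ω : Set Plane) (O : Fin L → Set Plane)
    (F : EuclideanSpace ℝ (Fin L)) (a b : Plane → ℝ) : L2 Ω × EuclideanSpace ℝ (Fin L) :=
  if h : ∃ p, IsWeakSolution Ω O a b F p then h.choose else 0

/-- The region `{x ∈ Ω : c_i ≤ u(x) < c_{i+1}}`. -/
def levelRegion {Ω : Set Plane} {M : ℕ} (c : Fin (M + 1) → EReal) (u : C(closure Ω, ℝ))
    (i : Fin M) : Set Plane :=
  {x | ∃ hx : x ∈ Ω, c i.castSucc ≤ ((u ⟨x, subset_closure hx⟩ : ℝ) : EReal) ∧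
    ((u ⟨x, subset_closure hx⟩ : ℝ) : EReal) < c i.succ}

/-- The level-set map `H(u) = ∑_i a_i 𝟙{x ∈ Ω : c_i ≤ u(x) < c_{i+1}}`. -/
def levelSetMap {Ω : Set Plane} {M : ℕ} (c : Fin (M + 1) → EReal) (a : Fin M → ℝ)
    (u : C(closure Ω, ℝ)) (x : Plane) : ℝ :=
  ∑ i, (levelRegion c u i).indicator (fun _ => a i) x

/-- The data space `ℝ^{LJ}`: the coordinate `(l, j)` is the `l`-th component of the measurement
for the `j`-th flux pattern. -/
abbrev Data (L J : ℕ) : Type := EuclideanSpace ℝ (Fin L × Fin J)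

/-- The forward map `G(u₁,u₂) = (Π ∘ ℳ_j (H₁(u₁), H₂(u₂)))_{j=1..J}`, with `Π(u,U) = U`. -/
def forwardMap {L J M N : ℕ} (Ω : Set Plane) (O : Fin L → Set Plane)
    (F : Fin J → EuclideanSpace ℝ (Fin L)) (c : Fin (M + 1) → EReal) (a : Fin M → ℝ)
    (d : Fin (N + 1) → EReal) (b : Fin N → ℝ) (u : C(closure Ω, ℝ) × C(closure Ω, ℝ)) :
    Data L J :=
  WithLp.toLp 2 fun k =>
    (solutionOperator Ω O (F k.2) (levelSetMap c a u.1) (levelSetMap d b u.2)).2 k.1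

/-- `Γ = diag(Γ₀, …, Γ₀)`, with `J` blocks. -/
abbrev noiseCov {L : ℕ} (J : ℕ) (Γ₀ : Matrix (Fin L) (Fin L) ℝ) :
    Matrix (Fin L × Fin J) (Fin L × Fin J) ℝ :=
  Matrix.blockDiagonal fun _ : Fin J => Γ₀

/-- The weighted norm `|y|_Γ = |Γ^{-1/2} y|`. -/
def weightedNorm {ι : Type*} [Fintype ι] [DecidableEq ι] (Γ : Matrix ι ι ℝ)
    (y : EuclideanSpace ℝ ι) : ℝ :=
  ‖Matrix.toEuclideanCLM (𝕜 := ℝ) (CFC.sqrt Γ)⁻¹ y‖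

/-- The potential `Φ(u; y) = ½ |y - G(u)|_Γ²`. -/
def potential {X ι : Type*} [Fintype ι] [DecidableEq ι] (Γ : Matrix ι ι ℝ)
    (G : X → EuclideanSpace ℝ ι) (u : X) (y : EuclideanSpace ℝ ι) : ℝ :=
  (1 / 2 : ℝ) * weightedNorm Γ (y - G u) ^ 2

/-- The normalizing factor `Z(y) = ∫ exp(-Φ(u; y)) μ⁰(du)`. -/
def normalizer {X ι : Type*} [MeasurableSpace X] [Fintype ι] [DecidableEq ι] (μ0 : Measure X)
    (Γ : Matrix ι ι ℝ) (G : X → EuclideanSpace ℝ ι) (y : EuclideanSpace ℝ ι) : ℝ :=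
  ∫ u, Real.exp (-potential Γ G u y) ∂μ0

/-- The joint law of `(y, u)` in the Bayesian model `y = G(u) + η`, where `u ∼ μ⁰` and the noise
`η ∼ N(0, Γ)` are independent. -/
def jointLaw {X ι : Type*} [MeasurableSpace X] [Fintype ι] [DecidableEq ι] (μ0 : Measure X)
    (Γ : Matrix ι ι ℝ) (G : X → EuclideanSpace ℝ ι) : Measure (EuclideanSpace ℝ ι × X) :=
  (μ0.prod (multivariateGaussian 0 Γ)).map fun q => (G q.1 + q.2, q.1)

/-- The Hellinger distance of two probability measures `p₁, p₂` that are absolutely continuous with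
respect to `p₀`:  `(½ ∫ (√(dp₁/dp₀) - √(dp₂/dp₀))² dp₀)^{1/2}`. -/
def hellingerDist {X : Type*} [MeasurableSpace X] (p0 p1 p2 : Measure X) : ℝ :=
  √((1 / 2 : ℝ) * ∫ x, (√(p1.rnDeriv p0 x).toReal - √(p2.rnDeriv p0 x).toReal) ^ 2 ∂p0)

end LevelSetBayes

end

open LevelSetBayes

/-!
The elliptic part rests on one inequality, the trace inequality
`∫_{∂Ω} φ² dS ≤ C ∫_Ω (φ² + |∇φ|²)` for smooth `φ` on a bounded Lipschitz domain
(`exists_trace_bound`). It is proved chart by chart, from the fundamental theorem of calculus on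
segments transversal to the boundary. It passes to the limit in the definition of the trace, and
so the set `sobolevSpace` of all `(u, ∇u, trace u, U)` is a closed subspace of a Hilbert space on
which the trace is bounded by the `H¹` norm. The bilinear form of the model is bounded there, and
coercive, with a constant that depends only on the lower bound of the coefficients
(`exists_coercive`), because every `O_l` has positive length. The Lax–Milgram theorem gives
existence and uniqueness (`existsUnique_isWeakSolution`). Coercivity also gives continuity of `U`
under bounded pointwise convergence of the coefficients (`tendsto_solutionOperator`).

The forward map itself need not be continuous, since a level set may have positive measure. But the
level-set map is composition with a step function, and a step function is the pointwise limit of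
continuous functions with values in the same interval. For continuous functions the forward map is
continuous in `(u₁, u₂)`, and so it is measurable as a limit of continuous maps
(`measurable_forwardMap`).

The Bayesian part holds for every measurable forward map. The noise has Lebesgue density
proportional to `exp(-|x|_Γ² / 2)`, and so the joint law of `(y, u)` has density `exp(-Φ(u; y))`,
up to a constant, with respect to the product of Lebesgue measure and the prior; normalizing in `u`
gives the posterior (`compProd_posteriorKernel`). For the Hellinger estimate
(`exists_hellingerDist_posteriorKernel_le`), `exp(-Φ(u; y) / 2)` is Lipschitz in `y` uniformly in
`u`, and `Z` is bounded below on bounded sets of data.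
-/

namespace LevelSetBayes

/-! ### The trace inequality for smooth functions -/

/-- A one-dimensional trace inequality: the value at an endpoint is controlled by the `H¹` norm on
the interval. -/
theorem sq_le_integral_sq_add_deriv_sq {r : ℝ} (hr : 0 < r) {f f' : ℝ → ℝ}
    (hf : ∀ t, HasDerivAt f (f' t) t) (hf' : Continuous f') :
    f 0 ^ 2 ≤ (1 + 1 / r) * ∫ t in (0 : ℝ)..r, (f t ^ 2 + f' t ^ 2) := by
  have hfc : Continuous f := continuous_iff_continuousAt.2 fun t => (hf t).continuousAt
  -- The weight `t - r` vanishes at `r`, so that only the value at `0` survives integration.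
  have hderiv : ∀ t ∈ Set.uIcc 0 r, HasDerivAt (fun t => (t - r) * f t ^ 2)
      (f t ^ 2 + (t - r) * (2 * f t * f' t)) t := by
    intro t _
    refine (((hasDerivAt_id t).sub_const r).mul ((hf t).pow 2)).congr_deriv ?_
    simp
  have hint := intervalIntegral.integral_eq_sub_of_hasDerivAt hderiv
    (Continuous.intervalIntegrable (by fun_prop) _ _)
  have hle : ∫ t in (0 : ℝ)..r, (f t ^ 2 + (t - r) * (2 * f t * f' t)) ≤
      ∫ t in (0 : ℝ)..r, (1 + r) * (f t ^ 2 + f' t ^ 2) := by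
    refine intervalIntegral.integral_mono_on hr.le
      (Continuous.intervalIntegrable (by fun_prop) _ _)
      (Continuous.intervalIntegrable (by fun_prop) _ _) fun t ht => ?_
    have h1 : 0 ≤ r - t := by linarith [ht.2]
    nlinarith [mul_nonneg h1 (sq_nonneg (f t + f' t)), mul_nonneg ht.1 (sq_nonneg (f t)),
      mul_nonneg ht.1 (sq_nonneg (f' t)), sq_nonneg (f' t)]
  rw [intervalIntegral.integral_const_mul] at hle
  have h2 : r * f 0 ^ 2 ≤ (1 + r) * ∫ t in (0 : ℝ)..r, (f t ^ 2 + f' t ^ 2) := by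
    rw [hint] at hle
    simpa using hle
  have h3 : (1 + 1 / r) * ∫ t in (0 : ℝ)..r, (f t ^ 2 + f' t ^ 2) =
      ((1 + r) * ∫ t in (0 : ℝ)..r, (f t ^ 2 + f' t ^ 2)) / r := by
    field_simp; ring
  rw [h3, le_div_iff₀ hr]; linarith

theorem enorm_sq_le_lintegral_add_deriv {r : ℝ} (hr : 0 < r) {f f' : ℝ → ℝ}
    (hf : ∀ t, HasDerivAt f (f' t) t) (hf' : Continuous f') :
    ‖f 0‖ₑ ^ 2 ≤ ENNReal.ofReal (1 + 1 / r) *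
      ∫⁻ t in Set.Ioo 0 r, (‖f t‖ₑ ^ 2 + ‖f' t‖ₑ ^ 2) := by
  have hfc : Continuous f := continuous_iff_continuousAt.2 fun t => (hf t).continuousAt
  have key : ∀ x : ℝ, ‖x‖ₑ ^ 2 = ENNReal.ofReal (x ^ 2) := fun x => by
    rw [← ofReal_norm, ← ENNReal.ofReal_pow (norm_nonneg _), Real.norm_eq_abs, sq_abs]
  simp_rw [key]
  have h := sq_le_integral_sq_add_deriv_sq hr hf hf'
  refine (ENNReal.ofReal_le_ofReal h).trans ?_
  rw [ENNReal.ofReal_mul (by positivity), intervalIntegral.integral_of_le hr.le,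
    ofReal_integral_eq_lintegral_ofReal]
  · rw [restrict_Ioo_eq_restrict_Ioc]
    refine le_of_eq (congrArg _ (lintegral_congr fun t => ?_))
    rw [ENNReal.ofReal_add (sq_nonneg (f t)) (sq_nonneg (f' t))]
  · have : Continuous fun t => f t ^ 2 + f' t ^ 2 := by fun_prop
    exact (this.integrableOn_Icc (a := 0) (b := r)).mono_set Set.Ioc_subset_Icc_self
  · exact ae_of_all _ fun t => by positivity

/-- The point of the plane whose coordinates in the frame `T` are `(s, t)`. -/
noncomputable def framePoint (T : Plane ≃ₗᵢ[ℝ] Plane) (q : ℝ × ℝ) : Plane :=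
  T.symm (WithLp.toLp 2 ![q.1, q.2])

theorem measurePreserving_framePoint (T : Plane ≃ₗᵢ[ℝ] Plane) :
    MeasurePreserving (framePoint T) volume volume := by
  have h1 := (volume_preserving_finTwoArrow ℝ).symm
  have h2 := (EuclideanSpace.volume_preserving_symm_measurableEquiv_toLp (Fin 2)).symm
  have h3 := T.symm.measurePreserving
  exact h3.comp (h2.comp h1)

theorem measurePreserving_shear {γ : ℝ → ℝ} (hγ : Measurable γ) :
    MeasurePreserving (fun q : ℝ × ℝ => (q.1, γ q.1 + q.2)) volume volume := by
  refine (MeasurePreserving.id volume).skew_product (g := fun s t => γ s + t) ?_ ?_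
  · fun_prop
  · exact ae_of_all _ fun s => (measurePreserving_add_left volume (γ s)).map_eq

theorem dist_framePoint_sq (T : Plane ≃ₗᵢ[ℝ] Plane) (q q' : ℝ × ℝ) :
    dist (framePoint T q) (framePoint T q') ^ 2 = (q.1 - q'.1) ^ 2 + (q.2 - q'.2) ^ 2 := by
  rw [framePoint, framePoint, T.symm.dist_map, EuclideanSpace.dist_eq, Real.sq_sqrt (by positivity)]
  simp [Real.dist_eq, sq_abs]

theorem lipschitzWith_graph (T : Plane ≃ₗᵢ[ℝ] Plane) {K : ℝ≥0} {γ : ℝ → ℝ}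
    (hγ : LipschitzWith K γ) : LipschitzWith (1 + K) fun s => framePoint T (s, γ s) := by
  refine LipschitzWith.of_dist_le_mul fun s s' => ?_
  refine abs_le_of_sq_le_sq' ?_ (by positivity) |>.2
  rw [dist_framePoint_sq]
  have h1 := hγ.dist_le_mul s s'
  rw [Real.dist_eq] at h1
  have h2 : (γ s - γ s') ^ 2 ≤ (K * dist s s') ^ 2 :=
    sq_le_sq' (by linarith [neg_abs_le (γ s - γ s')]) ((le_abs_self _).trans h1)
  have h3 : (s - s') ^ 2 = dist s s' ^ 2 := by rw [Real.dist_eq, sq_abs]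
  have h4 : (0:ℝ) ≤ K * dist s s' ^ 2 := by positivity
  push_cast
  rw [h3]
  nlinarith


theorem frame_framePoint (T : Plane ≃ₗᵢ[ℝ] Plane) (q : ℝ × ℝ) :
    T (framePoint T q) = WithLp.toLp 2 ![q.1, q.2] := by
  simp [framePoint]

theorem framePoint_frame (T : Plane ≃ₗᵢ[ℝ] Plane) (x : Plane) :
    framePoint T (T x 0, T x 1) = x := by
  rw [framePoint, LinearIsometryEquiv.symm_apply_eq]
  ext i
  fin_cases i <;> simp

/-- On a curve with a Lipschitz parametrization, arc length is at most the Lipschitz constant times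
the image of Lebesgue measure. -/
theorem lintegral_hausdorffMeasure_le {σ : ℝ → Plane} {K : ℝ≥0} (hσ : LipschitzWith K σ)
    {A : Set Plane} (hAσ : A ⊆ Set.range σ) {f : Plane → ℝ≥0∞}
    (hf : Measurable f) :
    ∫⁻ x in A, f x ∂(Measure.hausdorffMeasure 1 : Measure Plane) ≤
      K * ∫⁻ s in σ ⁻¹' A, f (σ s) := by
  have hσm : Measurable σ := hσ.continuous.measurable
  have hle : (Measure.hausdorffMeasure 1 : Measure Plane).restrict A ≤
      (K : ℝ≥0∞) • (volume.restrict (σ ⁻¹' A)).map σ := by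
    refine Measure.le_iff.2 fun B hB => ?_
    rw [Measure.restrict_apply hB, Measure.smul_apply, Measure.map_apply hσm hB,
      Measure.restrict_apply (hσm hB), ← Set.preimage_inter, smul_eq_mul]
    have h1 : B ∩ A = σ '' (σ ⁻¹' (B ∩ A)) :=
      (Set.image_preimage_eq_of_subset (Set.inter_subset_right.trans hAσ)).symm
    calc (Measure.hausdorffMeasure 1 : Measure Plane) (B ∩ A)
        = Measure.hausdorffMeasure 1 (σ '' (σ ⁻¹' (B ∩ A))) := by rw [← h1]
      _ ≤ (K : ℝ≥0∞) ^ (1 : ℝ) * Measure.hausdorffMeasure 1 (σ ⁻¹' (B ∩ A)) :=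
          hσ.hausdorffMeasure_image_le zero_le_one _
      _ = K * volume (σ ⁻¹' (B ∩ A)) := by rw [ENNReal.rpow_one, hausdorffMeasure_real]
  refine (lintegral_mono' hle le_rfl).trans ?_
  rw [lintegral_smul_measure, lintegral_map hf hσm, smul_eq_mul]

/-- In a coordinate chart of a Lipschitz domain the boundary lies on the graph. -/
theorem frame_one_eq_of_mem_frontier {Ω : Set Plane} (hΩ : IsOpen Ω)
    {T : Plane ≃ₗᵢ[ℝ] Plane} {K : ℝ≥0} {γ : ℝ → ℝ} {N : Set Plane} (hγ : LipschitzWith K γ)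
    (hN : IsOpen N) (h : ∀ x ∈ N, x ∈ Ω ↔ γ (T x 0) < T x 1) {x : Plane} (hx : x ∈ frontier Ω)
    (hxN : x ∈ N) : T x 1 = γ (T x 0) := by
  have hxΩ : x ∉ Ω := by
    rw [hΩ.frontier_eq] at hx
    exact hx.2
  have hle : T x 1 ≤ γ (T x 0) := not_lt.1 fun hlt => hxΩ ((h x hxN).2 hlt)
  refine hle.antisymm (not_lt.1 fun hlt => ?_)
  have hc : ∀ i, Continuous fun y : Plane => T y i := fun i => by fun_prop
  have hopen : IsOpen (N ∩ {y | T y 1 < γ (T y 0)}) :=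
    hN.inter (isOpen_lt (hc 1) (hγ.continuous.comp (hc 0)))
  obtain ⟨y, ⟨hyN, hy⟩, hyΩ⟩ := mem_closure_iff.1 (frontier_subset_closure hx) _ hopen ⟨hxN, hlt⟩
  exact lt_asymm hy ((h y hyN).1 hyΩ)

/-- The squared `H¹(Ω)` norm of a smooth function, as an extended nonnegative real, so that no
integrability has to be assumed. -/
noncomputable def sobolevEnergy (Ω : Set Plane) (φ : Plane → ℝ) : ℝ≥0∞ :=
  ∫⁻ x in Ω, (‖φ x‖ₑ ^ 2 + ‖gradient φ x‖ₑ ^ 2)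

theorem continuous_gradient {φ : Plane → ℝ} (hφ : ContDiff ℝ ∞ φ) : Continuous (gradient φ) := by
  unfold gradient
  exact (LinearIsometryEquiv.continuous _).comp (hφ.continuous_fderiv (by simp))

/-- The trace inequality near one boundary point: apply the one-dimensional inequality on the
vertical segments `t ↦ (s, γ s + t)`, `0 < t < r`, and integrate over `s`; the map
`(s, t) ↦ (s, γ s + t)` preserves area, and these segments stay in `Ω`. -/
theorem exists_local_trace_bound {Ω : Set Plane} (hΩ : IsLipschitzDomain Ω) {p : Plane}
    (hp : p ∈ frontier Ω) :
    ∃ r > 0, ∃ C : ℝ≥0∞, C ≠ ⊤ ∧ ∀ φ : Plane → ℝ, ContDiff ℝ ∞ φ →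
      ∫⁻ x in frontier Ω ∩ Metric.ball p r, ‖φ x‖ₑ ^ 2 ∂(Measure.hausdorffMeasure 1 : Measure Plane)
        ≤ C * sobolevEnergy Ω φ := by
  obtain ⟨T, K, γ, N, hγ, hN, hpN, hNΩ⟩ := hΩ.exists_graph p hp
  obtain ⟨ε, hε, hεN⟩ := Metric.isOpen_iff.1 hN p hpN
  obtain ⟨r, hr, rfl⟩ : ∃ r, 0 < r ∧ ε = 2 * r := ⟨ε / 2, by positivity, by ring⟩
  refine ⟨r, hr, ((1 + K : ℝ≥0) : ℝ≥0∞) * ENNReal.ofReal (1 + 1 / r),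
    ENNReal.mul_ne_top ENNReal.coe_ne_top ENNReal.ofReal_ne_top, fun φ hφ => ?_⟩
  set σ : ℝ → Plane := fun s => framePoint T (s, γ s) with hσdef
  set ψ : ℝ × ℝ → Plane := fun q => framePoint T (q.1, γ q.1 + q.2) with hψdef
  have hψ : MeasurePreserving ψ volume volume :=
    (measurePreserving_framePoint T).comp (measurePreserving_shear hγ.continuous.measurable)
  set A := frontier Ω ∩ Metric.ball p r with hAdef
  have hAσ : A ⊆ Set.range σ := by
    rintro x ⟨hx, hxr⟩
    have := frame_one_eq_of_mem_frontier hΩ.isOpen hγ hN hNΩ hx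
      (hεN (Metric.ball_subset_ball (by linarith) hxr))
    exact ⟨T x 0, by rw [hσdef]; simp only; rw [← this, framePoint_frame]⟩
  have hσ : LipschitzWith (1 + K) σ := lipschitzWith_graph T hγ
  have hgrad := continuous_gradient hφ
  set S := σ ⁻¹' A with hSdef
  set e : Plane := framePoint T (0, 1) with hedef
  have he : ‖e‖ = 1 := by
    rw [hedef, framePoint, LinearIsometryEquiv.norm_map, EuclideanSpace.norm_eq]
    simp
  have hψe : ∀ s t, ψ (s, t) = σ s + t • e := by
    intro s t
    simp only [hψdef, hσdef, hedef, framePoint]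
    rw [← map_smul, ← map_add]
    congr 1
    ext i
    fin_cases i <;> simp
  set f : Plane → ℝ≥0∞ := fun x => ‖φ x‖ₑ ^ 2 + ‖gradient φ x‖ₑ ^ 2 with hfdef
  have hfm : Measurable f := by
    have h1 := hφ.continuous.measurable
    have h2 := hgrad.measurable
    fun_prop
  have hline : ∀ s, ‖φ (σ s)‖ₑ ^ 2 ≤
      ENNReal.ofReal (1 + 1 / r) * ∫⁻ t in Set.Ioo 0 r, f (ψ (s, t)) := by
    intro s
    have hd : ∀ t : ℝ,
        HasDerivAt (fun t : ℝ => φ (σ s + t • e)) ⟪gradient φ (σ s + t • e), e⟫ t := by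
      intro t
      have h1 : HasDerivAt (fun t : ℝ => σ s + t • e) e t := by
        simpa using ((hasDerivAt_id t).smul_const e).const_add (σ s)
      have h2 := ((hφ.differentiable (by simp)) (σ s + t • e)).hasGradientAt.hasFDerivAt
      exact (h2.comp_hasDerivAt t h1).congr_deriv (InnerProductSpace.toDual_apply_apply)
    have h := enorm_sq_le_lintegral_add_deriv hr hd (by fun_prop)
    simp only [zero_smul, add_zero] at h
    refine h.trans ?_
    gcongr with t
    rw [hψe, hfdef]
    simp only
    gcongr
    rw [← ofReal_norm, ← ofReal_norm]
    refine ENNReal.ofReal_le_ofReal ((norm_inner_le_norm _ _).trans ?_)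
    rw [he, mul_one]
  have hsub : S ×ˢ Set.Ioo 0 r ⊆ ψ ⁻¹' Ω := by
    rintro ⟨s, t⟩ ⟨hs, ht⟩
    have hsA : σ s ∈ A := hs
    have hmem : ψ (s, t) ∈ N := by
      refine hεN ?_
      rw [Metric.mem_ball, hψe]
      have h1 : dist (σ s + t • e) (σ s) = t := by
        rw [dist_eq_norm, add_sub_cancel_left, norm_smul, he, mul_one, Real.norm_eq_abs,
          abs_of_pos ht.1]
      have h2 := Metric.mem_ball.1 hsA.2
      have h3 := dist_triangle (σ s + t • e) (σ s) p
      linarith [ht.2]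
    refine (hNΩ _ hmem).2 ?_
    simp only [hψdef]
    rw [frame_framePoint]
    simpa using ht.1
  calc ∫⁻ x in A, ‖φ x‖ₑ ^ 2 ∂(Measure.hausdorffMeasure 1 : Measure Plane)
      ≤ ((1 + K : ℝ≥0) : ℝ≥0∞) * ∫⁻ s in S, ‖φ (σ s)‖ₑ ^ 2 :=
        lintegral_hausdorffMeasure_le hσ hAσ (by have := hφ.continuous.measurable; fun_prop)
    _ ≤ ((1 + K : ℝ≥0) : ℝ≥0∞) *
          ∫⁻ s in S, ENNReal.ofReal (1 + 1 / r) * ∫⁻ t in Set.Ioo 0 r, f (ψ (s, t)) := by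
        gcongr with s
        exact hline s
    _ = ((1 + K : ℝ≥0) : ℝ≥0∞) * ENNReal.ofReal (1 + 1 / r) *
          ∫⁻ q in S ×ˢ Set.Ioo 0 r, f (ψ q) := by
        rw [lintegral_const_mul' _ _ ENNReal.ofReal_ne_top, mul_assoc, Measure.volume_eq_prod,
          ← Measure.prod_restrict,
          lintegral_prod (fun q => f (ψ q)) (hfm.comp hψ.measurable).aemeasurable]
    _ ≤ ((1 + K : ℝ≥0) : ℝ≥0∞) * ENNReal.ofReal (1 + 1 / r) * ∫⁻ q in ψ ⁻¹' Ω, f (ψ q) := by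
        gcongr
    _ = _ := by
        rw [hψ.setLIntegral_comp_preimage hΩ.isOpen.measurableSet hfm]
        rfl

/-- The trace inequality on a bounded Lipschitz domain, from finitely many charts. -/
theorem exists_trace_bound {Ω : Set Plane} (hΩ : IsLipschitzDomain Ω) :
    ∃ C : ℝ≥0∞, C ≠ ⊤ ∧ ∀ φ : Plane → ℝ, ContDiff ℝ ∞ φ →
      ∫⁻ x, ‖φ x‖ₑ ^ 2 ∂(surfaceMeasure Ω) ≤ C * sobolevEnergy Ω φ := by
  have hK : IsCompact (frontier Ω) :=
    Metric.isCompact_of_isClosed_isBounded isClosed_frontier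
      (hΩ.isBounded.closure.subset frontier_subset_closure)
  suffices H : ∃ C : ℝ≥0∞, C ≠ ⊤ ∧ ∀ φ : Plane → ℝ, ContDiff ℝ ∞ φ →
      ∫⁻ x in frontier Ω ∩ frontier Ω, ‖φ x‖ₑ ^ 2 ∂(Measure.hausdorffMeasure 1 : Measure Plane)
        ≤ C * sobolevEnergy Ω φ by
    rwa [Set.inter_self] at H
  refine hK.induction_on (p := fun s => ∃ C : ℝ≥0∞, C ≠ ⊤ ∧ ∀ φ : Plane → ℝ, ContDiff ℝ ∞ φ →
      ∫⁻ x in frontier Ω ∩ s, ‖φ x‖ₑ ^ 2 ∂(Measure.hausdorffMeasure 1 : Measure Plane)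
        ≤ C * sobolevEnergy Ω φ) ⟨0, by simp, fun φ _ => by simp⟩ ?_ ?_ ?_
  · rintro s t hst ⟨C, hC, h⟩
    exact ⟨C, hC, fun φ hφ => (lintegral_mono_set (Set.inter_subset_inter_right _ hst)).trans
      (h φ hφ)⟩
  · rintro s t ⟨C, hC, h⟩ ⟨C', hC', h'⟩
    refine ⟨C + C', ENNReal.add_ne_top.2 ⟨hC, hC'⟩, fun φ hφ => ?_⟩
    rw [Set.inter_union_distrib_left, add_mul]
    exact (lintegral_union_le _ _ _).trans (add_le_add (h φ hφ) (h' φ hφ))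
  · intro p hp
    obtain ⟨r, hr, C, hC, h⟩ := exists_local_trace_bound hΩ hp
    exact ⟨Metric.ball p r, mem_nhdsWithin_of_mem_nhds (Metric.ball_mem_nhds p hr), C, hC, h⟩

/-- The boundary has finite length: this is the trace inequality for the constant function `1`. -/
theorem isFiniteMeasure_surfaceMeasure {Ω : Set Plane} (hΩ : IsLipschitzDomain Ω) :
    IsFiniteMeasure (surfaceMeasure Ω) := by
  obtain ⟨C, hC, h⟩ := exists_trace_bound hΩ
  have h1 := h (fun _ => 1) contDiff_const
  refine ⟨?_⟩
  have hv : volume Ω < ⊤ := hΩ.isBounded.measure_lt_top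
  have h2 : sobolevEnergy Ω (fun _ => 1) = volume Ω := by
    simp [sobolevEnergy, gradient_fun_const]
  rw [h2] at h1
  simp only [enorm_one, one_pow, lintegral_one] at h1
  exact h1.trans_lt (ENNReal.mul_lt_top hC.lt_top hv)

/-! ### Traces and weak gradients -/

theorem eLpNorm_two_sq {α E : Type*} [MeasurableSpace α] [NormedAddCommGroup E] (f : α → E)
    (μ : Measure α) : eLpNorm f 2 μ ^ 2 = ∫⁻ x, ‖f x‖ₑ ^ 2 ∂μ := by
  have h := eLpNorm_nnreal_pow_eq_lintegral (f := f) (μ := μ) (p := 2) two_ne_zero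
  simpa using h

theorem exists_eLpNorm_trace_bound {Ω : Set Plane} (hΩ : IsLipschitzDomain Ω) :
    ∃ C : ℝ≥0, ∀ φ : Plane → ℝ, ContDiff ℝ ∞ φ →
      eLpNorm φ 2 (surfaceMeasure Ω) ≤ C * (eLpNorm φ 2 (volume.restrict Ω) +
        eLpNorm (gradient φ) 2 (volume.restrict Ω)) := by
  obtain ⟨C, hC, h⟩ := exists_trace_bound hΩ
  lift C to ℝ≥0 using hC
  refine ⟨1 + C, fun φ hφ => ?_⟩
  have h1 := h φ hφ
  have hm : Measurable fun x => ‖φ x‖ₑ ^ 2 := by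
    have := hφ.continuous.measurable
    fun_prop
  rw [sobolevEnergy, lintegral_add_left hm, ← eLpNorm_two_sq, ← eLpNorm_two_sq,
    ← eLpNorm_two_sq] at h1
  set A := eLpNorm φ 2 (volume.restrict Ω)
  set B := eLpNorm (gradient φ) 2 (volume.restrict Ω)
  refine (ENNReal.pow_le_pow_left_iff two_ne_zero).1 (h1.trans ?_)
  rw [mul_pow]
  gcongr
  · push_cast
    calc (C : ℝ≥0∞) ≤ (1 + C) * 1 := by simp
      _ ≤ (1 + C) * (1 + C) := by gcongr; simp
      _ = (1 + C) ^ 2 := (sq _).symm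
  · calc A ^ 2 + B ^ 2 ≤ A ^ 2 + 2 * A * B + B ^ 2 := by gcongr; simp
      _ = (A + B) ^ 2 := by ring

theorem IsTrace.enorm_le {Ω : Set Plane} {C : ℝ≥0} (hC : ∀ φ : Plane → ℝ, ContDiff ℝ ∞ φ →
      eLpNorm φ 2 (surfaceMeasure Ω) ≤ C * (eLpNorm φ 2 (volume.restrict Ω) +
        eLpNorm (gradient φ) 2 (volume.restrict Ω)))
    {u : L2 Ω} {Du : L2Vec Ω} {g : L2Bdry Ω} (h : IsTrace Ω u Du g) :
    ‖g‖ₑ ≤ C * (‖u‖ₑ + ‖Du‖ₑ) := by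
  obtain ⟨φ, hφ, h1, h2, h3⟩ := h
  simp only [Lp.enorm_def]
  have hle : ∀ n, eLpNorm g 2 (surfaceMeasure Ω) ≤
      eLpNorm (fun x => φ n x - g x) 2 (surfaceMeasure Ω) +
        C * ((eLpNorm (fun x => φ n x - u x) 2 (volume.restrict Ω) +
            eLpNorm u 2 (volume.restrict Ω)) +
          (eLpNorm (fun x => gradient (φ n) x - Du x) 2 (volume.restrict Ω) +
            eLpNorm Du 2 (volume.restrict Ω))) := by
    intro n
    have hφm := (hφ n).continuous
    have hgm := continuous_gradient (hφ n)
    have e1 : eLpNorm g 2 (surfaceMeasure Ω) ≤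
        eLpNorm (fun x => φ n x - g x) 2 (surfaceMeasure Ω) +
          eLpNorm (φ n) 2 (surfaceMeasure Ω) := by
      have := eLpNorm_sub_le (μ := surfaceMeasure Ω) (p := 2) (f := φ n)
        (g := fun x => φ n x - g x) hφm.aestronglyMeasurable
        (hφm.aestronglyMeasurable.sub (Lp.aestronglyMeasurable g)) (by norm_num)
      rw [add_comm]
      convert this using 2
      ext x; simp
    have e2 : eLpNorm (φ n) 2 (volume.restrict Ω) ≤
        eLpNorm (fun x => φ n x - u x) 2 (volume.restrict Ω) +
            eLpNorm u 2 (volume.restrict Ω) := by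
      have := eLpNorm_add_le (μ := volume.restrict Ω) (p := 2) (f := fun x => φ n x - u x) (g := u)
        (hφm.aestronglyMeasurable.sub (Lp.aestronglyMeasurable u)) (Lp.aestronglyMeasurable u)
        (by norm_num)
      convert this using 2
      ext x; simp
    have e3 : eLpNorm (gradient (φ n)) 2 (volume.restrict Ω) ≤
        eLpNorm (fun x => gradient (φ n) x - Du x) 2 (volume.restrict Ω) +
            eLpNorm Du 2 (volume.restrict Ω) := by
      have := eLpNorm_add_le (μ := volume.restrict Ω) (p := 2)
        (f := fun x => gradient (φ n) x - Du x) (g := Du)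
        (hgm.aestronglyMeasurable.sub (Lp.aestronglyMeasurable Du)) (Lp.aestronglyMeasurable Du)
        (by norm_num)
      convert this using 2
      ext x; simp
    refine e1.trans ?_
    gcongr
    refine (hC _ (hφ n)).trans ?_
    gcongr
  have hlim := h3.add (ENNReal.Tendsto.const_mul (a := (C : ℝ≥0∞)) ((h1.add_const
    (eLpNorm u 2 (volume.restrict Ω))).add (h2.add_const (eLpNorm Du 2 (volume.restrict Ω))))
    (Or.inr ENNReal.coe_ne_top))
  simpa using ge_of_tendsto' hlim hle

/-- On a bounded Lipschitz domain the trace is controlled by the `H¹` norm. -/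
theorem exists_norm_trace_le {Ω : Set Plane} (hΩ : IsLipschitzDomain Ω) :
    ∃ C : ℝ, 0 ≤ C ∧ ∀ (u : L2 Ω) (Du : L2Vec Ω) (g : L2Bdry Ω), IsTrace Ω u Du g →
      ‖g‖ ≤ C * (‖u‖ + ‖Du‖) := by
  obtain ⟨C, hC⟩ := exists_eLpNorm_trace_bound hΩ
  refine ⟨C, C.2, fun u Du g h => ?_⟩
  have h1 := IsTrace.enorm_le hC h
  simp only [← ofReal_norm] at h1
  rw [← ENNReal.ofReal_add (norm_nonneg _) (norm_nonneg _), ← ENNReal.ofReal_coe_nnreal,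
    ← ENNReal.ofReal_mul C.coe_nonneg] at h1
  exact (ENNReal.ofReal_le_ofReal_iff (by positivity)).1 h1

/-- The `ε` form of the definition of the trace, from which closedness is immediate. -/
theorem isTrace_iff {Ω : Set Plane} {u : L2 Ω} {Du : L2Vec Ω} {g : L2Bdry Ω} :
    IsTrace Ω u Du g ↔ ∀ ε : ℝ≥0∞, 0 < ε → ∃ φ : Plane → ℝ, ContDiff ℝ ∞ φ ∧
      eLpNorm (fun x => φ x - u x) 2 (volume.restrict Ω) ≤ ε ∧
      eLpNorm (fun x => gradient φ x - Du x) 2 (volume.restrict Ω) ≤ ε ∧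
      eLpNorm (fun x => φ x - g x) 2 (surfaceMeasure Ω) ≤ ε := by
  constructor
  · rintro ⟨φ, hφ, h1, h2, h3⟩ ε hε
    obtain ⟨n, e1, e2, e3⟩ := (((ENNReal.tendsto_nhds_zero.1 h1) ε hε).and
      (((ENNReal.tendsto_nhds_zero.1 h2) ε hε).and ((ENNReal.tendsto_nhds_zero.1 h3) ε hε))).exists
    exact ⟨φ n, hφ n, e1, e2, e3⟩
  · intro h
    obtain ⟨ε, -, hε, hlim⟩ := exists_seq_strictAnti_tendsto' (zero_lt_one (α := ℝ≥0∞))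
    choose φ hφ h1 h2 h3 using fun n => h (ε n) (hε n).1
    exact ⟨φ, hφ, tendsto_of_tendsto_of_tendsto_of_le_of_le tendsto_const_nhds hlim
        (fun _ => zero_le) h1, tendsto_of_tendsto_of_tendsto_of_le_of_le tendsto_const_nhds hlim
        (fun _ => zero_le) h2, tendsto_of_tendsto_of_tendsto_of_le_of_le tendsto_const_nhds hlim
        (fun _ => zero_le) h3⟩

theorem eLpNorm_sub_coe_le {α E : Type*} [MeasurableSpace α] {μ : Measure α}
    [NormedAddCommGroup E] {f : α → E} (hf : AEStronglyMeasurable f μ) (u v : Lp E 2 μ) :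
    eLpNorm (fun x => f x - u x) 2 μ ≤ eLpNorm (fun x => f x - v x) 2 μ + ‖v - u‖ₑ := by
  rw [Lp.enorm_def]
  refine le_trans (le_of_eq ?_) (eLpNorm_add_le (hf.sub (Lp.aestronglyMeasurable v))
    (Lp.aestronglyMeasurable (v - u)) (by norm_num))
  refine eLpNorm_congr_ae ?_
  filter_upwards [Lp.coeFn_sub v u] with x hx
  rw [Pi.add_apply, hx, Pi.sub_apply, sub_add_sub_cancel]

theorem eLpNorm_add_sub_coe_le {α E : Type*} [MeasurableSpace α] {μ : Measure α}
    [NormedAddCommGroup E] {f f' : α → E} (hf : AEStronglyMeasurable f μ)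
    (hf' : AEStronglyMeasurable f' μ) (u v : Lp E 2 μ) :
    eLpNorm (fun x => (f x + f' x) - (u + v : Lp E 2 μ) x) 2 μ ≤
      eLpNorm (fun x => f x - u x) 2 μ + eLpNorm (fun x => f' x - v x) 2 μ := by
  refine le_trans (le_of_eq ?_) (eLpNorm_add_le (hf.sub (Lp.aestronglyMeasurable u))
    (hf'.sub (Lp.aestronglyMeasurable v)) (by norm_num))
  refine eLpNorm_congr_ae ?_
  filter_upwards [Lp.coeFn_add u v] with x hx
  simp only [hx, Pi.add_apply]
  abel

theorem eLpNorm_smul_sub_coe {α E : Type*} [MeasurableSpace α] {μ : Measure α}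
    [NormedAddCommGroup E] [NormedSpace ℝ E] {f : α → E} (c : ℝ) (u : Lp E 2 μ) :
    eLpNorm (fun x => c • f x - (c • u : Lp E 2 μ) x) 2 μ =
      ‖c‖ₑ * eLpNorm (fun x => f x - u x) 2 μ := by
  rw [← eLpNorm_const_smul]
  refine eLpNorm_congr_ae ?_
  filter_upwards [Lp.coeFn_smul c u] with x hx
  simp only [hx, Pi.smul_apply, smul_sub]

theorem gradient_add_of_contDiff {φ ψ : Plane → ℝ} (hφ : ContDiff ℝ ∞ φ) (hψ : ContDiff ℝ ∞ ψ)
    (x : Plane) : gradient (fun y => φ y + ψ y) x = gradient φ x + gradient ψ x := by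
  unfold gradient
  rw [← map_add, fderiv_fun_add (hφ.differentiable (by simp) x) (hψ.differentiable (by simp) x)]

theorem gradient_smul_of_contDiff {φ : Plane → ℝ} (hφ : ContDiff ℝ ∞ φ) (c : ℝ) (x : Plane) :
    gradient (fun y => c • φ y) x = c • gradient φ x := by
  unfold gradient
  rw [fderiv_fun_const_smul (hφ.differentiable (by simp) x)]
  simp

theorem IsTrace.zero (Ω : Set Plane) : IsTrace Ω 0 0 0 := by
  refine isTrace_iff.2 fun ε hε => ⟨fun _ => 0, contDiff_const, ?_, ?_, ?_⟩
  · rw [eLpNorm_congr_ae (g := fun _ => 0)]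
    · simp
    · filter_upwards [Lp.coeFn_zero ℝ 2 (volume.restrict Ω)] with x hx
      rw [hx, Pi.zero_apply, sub_zero]
  · rw [eLpNorm_congr_ae (g := fun _ => 0)]
    · simp
    · filter_upwards [Lp.coeFn_zero Plane 2 (volume.restrict Ω)] with x hx
      rw [hx, Pi.zero_apply, sub_zero, gradient_fun_const]
  · rw [eLpNorm_congr_ae (g := fun _ => 0)]
    · simp
    · filter_upwards [Lp.coeFn_zero ℝ 2 (surfaceMeasure Ω)] with x hx
      rw [hx, Pi.zero_apply, sub_zero]

theorem IsTrace.add {Ω : Set Plane} {u v : L2 Ω} {Du Dv : L2Vec Ω} {g h : L2Bdry Ω}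
    (hu : IsTrace Ω u Du g) (hv : IsTrace Ω v Dv h) : IsTrace Ω (u + v) (Du + Dv) (g + h) := by
  rw [isTrace_iff] at *
  intro ε hε
  obtain ⟨φ, hφ, h1, h2, h3⟩ := hu (ε / 2) (ENNReal.half_pos hε.ne')
  obtain ⟨ψ, hψ, k1, k2, k3⟩ := hv (ε / 2) (ENNReal.half_pos hε.ne')
  refine ⟨fun x => φ x + ψ x, hφ.add hψ, ?_, ?_, ?_⟩
  · refine (eLpNorm_add_sub_coe_le hφ.continuous.aestronglyMeasurable
      hψ.continuous.aestronglyMeasurable u v).trans ?_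
    exact (add_le_add h1 k1).trans (ENNReal.add_halves ε).le
  · simp only [gradient_add_of_contDiff hφ hψ]
    refine (eLpNorm_add_sub_coe_le (continuous_gradient hφ).aestronglyMeasurable
      (continuous_gradient hψ).aestronglyMeasurable Du Dv).trans ?_
    exact (add_le_add h2 k2).trans (ENNReal.add_halves ε).le
  · refine (eLpNorm_add_sub_coe_le hφ.continuous.aestronglyMeasurable
      hψ.continuous.aestronglyMeasurable g h).trans ?_
    exact (add_le_add h3 k3).trans (ENNReal.add_halves ε).le

theorem IsTrace.smul {Ω : Set Plane} {u : L2 Ω} {Du : L2Vec Ω} {g : L2Bdry Ω}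
    (hu : IsTrace Ω u Du g) (c : ℝ) : IsTrace Ω (c • u) (c • Du) (c • g) := by
  obtain ⟨φ, hφ, h1, h2, h3⟩ := hu
  have key : ∀ {f : ℕ → ℝ≥0∞}, Tendsto f atTop (𝓝 0) →
      Tendsto (fun n => ‖c‖ₑ * f n) atTop (𝓝 0) := fun hf => by
    simpa using ENNReal.Tendsto.const_mul (a := ‖c‖ₑ) hf (Or.inr enorm_ne_top)
  refine ⟨fun n x => c • φ n x, fun n => (hφ n).const_smul c, ?_, ?_, ?_⟩
  · simpa only [eLpNorm_smul_sub_coe] using key h1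
  · simpa only [gradient_smul_of_contDiff (hφ _), eLpNorm_smul_sub_coe] using key h2
  · simpa only [eLpNorm_smul_sub_coe] using key h3

theorem isClosed_isTrace (Ω : Set Plane) :
    IsClosed {q : L2 Ω × L2Vec Ω × L2Bdry Ω | IsTrace Ω q.1 q.2.1 q.2.2} := by
  refine isClosed_of_closure_subset fun q hq => isTrace_iff.2 fun ε hε => ?_
  obtain ⟨p, hp, hpq⟩ := EMetric.mem_closure_iff.1 hq (ε / 2) (ENNReal.half_pos hε.ne')
  obtain ⟨φ, hφ, h1, h2, h3⟩ := isTrace_iff.1 hp (ε / 2) (ENNReal.half_pos hε.ne')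
  rw [edist_comm, Prod.edist_eq, Prod.edist_eq] at hpq
  simp only [max_lt_iff, edist_eq_enorm_sub] at hpq
  refine ⟨φ, hφ, ?_, ?_, ?_⟩
  · exact (eLpNorm_sub_coe_le hφ.continuous.aestronglyMeasurable _ p.1).trans
      ((add_le_add h1 hpq.1.le).trans (ENNReal.add_halves ε).le)
  · exact (eLpNorm_sub_coe_le (continuous_gradient hφ).aestronglyMeasurable _ p.2.1).trans
      ((add_le_add h2 hpq.2.1.le).trans (ENNReal.add_halves ε).le)
  · exact (eLpNorm_sub_coe_le hφ.continuous.aestronglyMeasurable _ p.2.2).trans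
      ((add_le_add h3 hpq.2.2.le).trans (ENNReal.add_halves ε).le)

/-- For a fixed test function the defect in the definition of the weak gradient is a bounded linear
map on `L²(Ω) × L²(Ω; ℝ²)`. -/
theorem exists_weakGradient_functional (Ω : Set Plane) {φ : Plane → ℝ} (hφ : ContDiff ℝ ∞ φ)
    (hc : HasCompactSupport φ) : ∃ A : L2 Ω × L2Vec Ω →L[ℝ] Plane, ∀ q,
      A q = (∫ x in Ω, q.1 x • gradient φ x) + ∫ x in Ω, φ x • q.2 x := by
  have hφL : MemLp φ 2 (volume.restrict Ω) := hφ.continuous.memLp_of_hasCompactSupport hc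
  have hgc : HasCompactSupport (gradient φ) :=
    (hc.fderiv (𝕜 := ℝ)).comp_left (map_zero _)
  have hgL : MemLp (gradient φ) 2 (volume.restrict Ω) :=
    (continuous_gradient hφ).memLp_of_hasCompactSupport hgc
  set B := ContinuousLinearMap.lsmul ℝ ℝ (E := Plane)
  refine ⟨((B.lpPairing (volume.restrict Ω) 2 2).flip hgL.toLp).comp
    (ContinuousLinearMap.fst ℝ _ _) + ((B.lpPairing (volume.restrict Ω) 2 2) hφL.toLp).comp
    (ContinuousLinearMap.snd ℝ _ _), fun q => ?_⟩
  simp only [add_apply, ContinuousLinearMap.comp_apply,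
    ContinuousLinearMap.flip_apply, ContinuousLinearMap.lpPairing_eq_integral]
  congr 1
  · refine integral_congr_ae ?_
    filter_upwards [hgL.coeFn_toLp] with x hx
    simp [hx, B]
  · refine integral_congr_ae ?_
    filter_upwards [hφL.coeFn_toLp] with x hx
    simp [hx, B]

/-- The pairs `(u, Du)` of an `H¹` function and its weak gradient. -/
def weakGradientGraph (Ω : Set Plane) : Submodule ℝ (L2 Ω × L2Vec Ω) where
  carrier := {q | IsWeakGradient Ω q.1 q.2}
  zero_mem' := fun φ hφ hc _ => by
    obtain ⟨A, hA⟩ := exists_weakGradient_functional Ω hφ hc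
    exact eq_neg_of_add_eq_zero_left ((hA 0).symm.trans (map_zero A))
  add_mem' := fun {p q} hp hq φ hφ hc hs => by
    obtain ⟨A, hA⟩ := exists_weakGradient_functional Ω hφ hc
    refine eq_neg_of_add_eq_zero_left ((hA (p + q)).symm.trans ?_)
    rw [map_add, hA, hA, hp φ hφ hc hs, hq φ hφ hc hs]
    simp
  smul_mem' := fun c {p} hp φ hφ hc hs => by
    obtain ⟨A, hA⟩ := exists_weakGradient_functional Ω hφ hc
    refine eq_neg_of_add_eq_zero_left ((hA (c • p)).symm.trans ?_)
    rw [map_smul, hA, hp φ hφ hc hs]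
    simp

theorem isClosed_weakGradientGraph (Ω : Set Plane) :
    IsClosed (weakGradientGraph Ω : Set (L2 Ω × L2Vec Ω)) := by
  have : (weakGradientGraph Ω : Set (L2 Ω × L2Vec Ω)) =
      ⋂ (φ : Plane → ℝ) (_ : ContDiff ℝ ∞ φ) (_ : HasCompactSupport φ) (_ : tsupport φ ⊆ Ω),
        {q | (∫ x in Ω, q.1 x • gradient φ x) + ∫ x in Ω, φ x • q.2 x = 0} := by
    ext q
    simp only [Set.mem_iInter, Set.mem_ofPred_eq, add_eq_zero_iff_eq_neg]
    rfl
  rw [this]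
  refine isClosed_iInter fun φ => isClosed_iInter fun hφ => isClosed_iInter fun hc =>
    isClosed_iInter fun _ => ?_
  obtain ⟨A, hA⟩ := exists_weakGradient_functional Ω hφ hc
  simp_rw [← hA]
  exact isClosed_eq A.continuous continuous_const

/-! ### The Sobolev space as a closed subspace of a Hilbert space -/

/-- The Hilbert space `L²(Ω) ⊕ L²(Ω; ℝ²) ⊕ L²(∂Ω) ⊕ ℝ^L` in which the quadruples
`(u, ∇u, trace u, U)` live. The sums are nested `ℓ²` sums of two spaces. -/
abbrev StateSpace (Ω : Set Plane) (L : ℕ) : Type :=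
  WithLp 2 (L2 Ω × WithLp 2 (L2Vec Ω × WithLp 2 (L2Bdry Ω × EuclideanSpace ℝ (Fin L))))

namespace StateSpace
variable {Ω : Set Plane} {L : ℕ}

/-- The function component `u`. -/
noncomputable def fn : StateSpace Ω L →L[ℝ] L2 Ω := WithLp.fstL 2 ℝ _ _

/-- The gradient component `∇u`. -/
noncomputable def grad : StateSpace Ω L →L[ℝ] L2Vec Ω :=
  (WithLp.fstL 2 ℝ _ _).comp (WithLp.sndL 2 ℝ _ _)

/-- The trace component. -/
noncomputable def trace : StateSpace Ω L →L[ℝ] L2Bdry Ω :=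
  (WithLp.fstL 2 ℝ _ _).comp ((WithLp.sndL 2 ℝ _ _).comp (WithLp.sndL 2 ℝ _ _))

/-- The vector component `U`. -/
noncomputable def vec : StateSpace Ω L →L[ℝ] EuclideanSpace ℝ (Fin L) :=
  (WithLp.sndL 2 ℝ _ _).comp ((WithLp.sndL 2 ℝ _ _).comp (WithLp.sndL 2 ℝ _ _))

theorem norm_sq_eq (p : StateSpace Ω L) :
    ‖p‖ ^ 2 = ‖fn p‖ ^ 2 + ‖grad p‖ ^ 2 + ‖trace p‖ ^ 2 + ‖vec p‖ ^ 2 := by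
  rw [WithLp.prod_norm_sq_eq_of_L2, WithLp.prod_norm_sq_eq_of_L2, WithLp.prod_norm_sq_eq_of_L2]
  simp only [fn, grad, trace, vec, ContinuousLinearMap.comp_apply, add_assoc]
  rfl

/-- The element with the given components. -/
noncomputable def mk (u : L2 Ω) (Du : L2Vec Ω) (g : L2Bdry Ω) (U : EuclideanSpace ℝ (Fin L)) :
    StateSpace Ω L :=
  WithLp.toLp 2 (u, WithLp.toLp 2 (Du, WithLp.toLp 2 (g, U)))

@[simp] theorem fn_mk (u : L2 Ω) (Du : L2Vec Ω) (g : L2Bdry Ω) (U : EuclideanSpace ℝ (Fin L)) :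
    fn (mk u Du g U) = u := rfl
@[simp] theorem grad_mk (u : L2 Ω) (Du : L2Vec Ω) (g : L2Bdry Ω) (U : EuclideanSpace ℝ (Fin L)) :
    grad (mk u Du g U) = Du := rfl
@[simp] theorem trace_mk (u : L2 Ω) (Du : L2Vec Ω) (g : L2Bdry Ω) (U : EuclideanSpace ℝ (Fin L)) :
    trace (mk u Du g U) = g := rfl
@[simp] theorem vec_mk (u : L2 Ω) (Du : L2Vec Ω) (g : L2Bdry Ω) (U : EuclideanSpace ℝ (Fin L)) :
    vec (mk u Du g U) = U := rfl

-- Unfolding the nested sums in definitional equality checks is very slow.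
attribute [irreducible] fn grad trace vec

end StateSpace

open StateSpace

/-- `H¹(Ω) ⊕ ℝ^L`, every element `u` of `H¹(Ω)` being recorded with its gradient and trace. -/
noncomputable def sobolevSpace (Ω : Set Plane) (L : ℕ) : Submodule ℝ (StateSpace Ω L) where
  carrier := {p | IsWeakGradient Ω (fn p) (grad p) ∧ IsTrace Ω (fn p) (grad p) (trace p)}
  zero_mem' := by
    change IsWeakGradient Ω (fn 0) (grad 0) ∧ IsTrace Ω (fn 0) (grad 0) (trace 0)
    rw [map_zero, map_zero, map_zero]
    exact ⟨(weakGradientGraph Ω).zero_mem, IsTrace.zero Ω⟩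
  add_mem' := fun {p q} hp hq => by
    change IsWeakGradient Ω (fn (p + q)) (grad (p + q)) ∧
      IsTrace Ω (fn (p + q)) (grad (p + q)) (trace (p + q))
    rw [map_add, map_add, map_add]
    exact ⟨(weakGradientGraph Ω).add_mem (x := (fn p, grad p)) (y := (fn q, grad q)) hp.1 hq.1,
      IsTrace.add hp.2 hq.2⟩
  smul_mem' := fun c {p} hp => by
    change IsWeakGradient Ω (fn (c • p)) (grad (c • p)) ∧
      IsTrace Ω (fn (c • p)) (grad (c • p)) (trace (c • p))
    rw [map_smul, map_smul, map_smul]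
    exact ⟨(weakGradientGraph Ω).smul_mem c (x := (fn p, grad p)) hp.1, IsTrace.smul hp.2 c⟩

theorem mem_sobolevSpace {Ω : Set Plane} {L : ℕ} {p : StateSpace Ω L} :
    p ∈ sobolevSpace Ω L ↔
      IsWeakGradient Ω (fn p) (grad p) ∧ IsTrace Ω (fn p) (grad p) (trace p) := Iff.rfl

theorem isClosed_sobolevSpace (Ω : Set Plane) (L : ℕ) :
    IsClosed (sobolevSpace Ω L : Set (StateSpace Ω L)) := by
  have h1 := (isClosed_weakGradientGraph Ω).preimage
    ((fn (Ω := Ω) (L := L)).continuous.prodMk grad.continuous)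
  have h2 := (isClosed_isTrace Ω).preimage
    ((fn (Ω := Ω) (L := L)).continuous.prodMk (grad.continuous.prodMk trace.continuous))
  exact h1.inter h2

/-! ### Lax–Milgram and weighted pairings -/

section LaxMilgram

variable {H : Type*} [NormedAddCommGroup H] [InnerProductSpace ℝ H] {V : Submodule ℝ H}
  {B : H →L[ℝ] H →L[ℝ] ℝ} {α : ℝ} {f : H →L[ℝ] ℝ}

/-- The Lax–Milgram theorem on a closed subspace. -/
theorem exists_forall_eq_of_coercive [CompleteSpace H] (hV : IsClosed (V : Set H)) (hα : 0 < α)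
    (hB : ∀ p ∈ V, α * ‖p‖ ^ 2 ≤ B p p) (f : H →L[ℝ] ℝ) : ∃ q ∈ V, ∀ r ∈ V, B q r = f r := by
  have : CompleteSpace V := hV.completeSpace_coe
  have hBV : IsCoercive (B.bilinearComp V.subtypeL V.subtypeL) := by
    refine ⟨α, hα, fun p => ?_⟩
    rw [mul_assoc, ← sq]
    exact hB p p.2
  set g : V := (InnerProductSpace.toDual ℝ V).symm (f.comp V.subtypeL) with hg
  refine ⟨hBV.continuousLinearEquivOfBilin.symm g, SetLike.coe_mem _, fun r hr => ?_⟩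
  have h := hBV.continuousLinearEquivOfBilin_apply (hBV.continuousLinearEquivOfBilin.symm g) ⟨r, hr⟩
  rw [ContinuousLinearEquiv.apply_symm_apply, hg, InnerProductSpace.toDual_symm_apply] at h
  exact h.symm

theorem eq_of_coercive (hα : 0 < α) (hB : ∀ p ∈ V, α * ‖p‖ ^ 2 ≤ B p p) {q q' : H}
    (hq : q ∈ V) (hq' : q' ∈ V) (h : ∀ r ∈ V, B q r = f r) (h' : ∀ r ∈ V, B q' r = f r) :
    q = q' := by
  have hd : q - q' ∈ V := sub_mem hq hq'
  have h1 := hB _ hd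
  have h0 : B (q - q') (q - q') = 0 := by
    rw [map_sub B, sub_apply, h _ hd, h' _ hd, sub_self]
  rw [h0] at h1
  have h2 : ‖q - q'‖ ^ 2 ≤ 0 := by
    by_contra hne
    exact absurd h1 (not_le.2 (mul_pos hα (not_le.1 hne)))
  exact sub_eq_zero.1 (norm_eq_zero.1 (pow_eq_zero_iff two_ne_zero |>.1
    (h2.antisymm (sq_nonneg _))))

end LaxMilgram

section Pairing

variable {α E : Type*} [MeasurableSpace α] {μ : Measure α} [NormedAddCommGroup E]
  [InnerProductSpace ℝ E]

/-- The bounded bilinear form `(f, g) ↦ ∫ m ⟪f, g⟫` on `L²`, for a bounded weight `m`. -/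
noncomputable def weightedPairing (m : Lp ℝ ∞ μ) : Lp E 2 μ →L[ℝ] Lp E 2 μ →L[ℝ] ℝ :=
  ((innerSL ℝ).lpPairing μ 2 2).comp ((ContinuousLinearMap.lsmul ℝ ℝ).holderL μ ∞ 2 2 m)

theorem weightedPairing_apply (m : Lp ℝ ∞ μ) (f g : Lp E 2 μ) :
    weightedPairing m f g = ∫ x, m x * ⟪f x, g x⟫ ∂μ := by
  rw [weightedPairing, ContinuousLinearMap.comp_apply, ContinuousLinearMap.lpPairing_eq_integral]
  refine integral_congr_ae ?_
  have h : (ContinuousLinearMap.lsmul ℝ ℝ).holderL μ ∞ 2 2 m f =ᵐ[μ] fun x => m x • f x := by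
    simpa using ContinuousLinearMap.coeFn_holder (ContinuousLinearMap.lsmul ℝ ℝ) m f
  filter_upwards [h] with x hx
  rw [hx, innerSL_apply_apply, real_inner_smul_left]

theorem exists_weightedPairing {m : α → ℝ} (hm : MemLp m ∞ μ) :
    ∃ B : Lp E 2 μ →L[ℝ] Lp E 2 μ →L[ℝ] ℝ, ∀ f g, B f g = ∫ x, m x * ⟪f x, g x⟫ ∂μ := by
  refine ⟨weightedPairing hm.toLp, fun f g => ?_⟩
  rw [weightedPairing_apply]
  refine integral_congr_ae ?_
  filter_upwards [hm.coeFn_toLp] with x hx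
  rw [hx]

theorem integrable_mul_inner {m : α → ℝ} (hm : MemLp m ∞ μ) (f g : Lp E 2 μ) :
    Integrable (fun x => m x * ⟪f x, g x⟫) μ := by
  have h1 : MemLp (fun x => ⟪f x, g x⟫) 1 μ :=
    memLp_one_iff_integrable.2 (L2.integrable_inner f g)
  exact memLp_one_iff_integrable.1 (h1.mul hm)

theorem L2_norm_sq (f : Lp E 2 μ) : ‖f‖ ^ 2 = ∫ x, ‖f x‖ ^ 2 ∂μ := by
  rw [← real_inner_self_eq_norm_sq, L2.inner_def]
  simp_rw [real_inner_self_eq_norm_sq]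

theorem integrable_L2_norm_sq (f : Lp E 2 μ) : Integrable (fun x => ‖f x‖ ^ 2) μ := by
  simpa only [real_inner_self_eq_norm_sq] using L2.integrable_inner (𝕜 := ℝ) f f

theorem mul_norm_sq_le_integral {m : α → ℝ} {lo : ℝ} (hm : MemLp m ∞ μ) (hlo : ∀ᵐ x ∂μ, lo ≤ m x)
    (f : Lp E 2 μ) : lo * ‖f‖ ^ 2 ≤ ∫ x, m x * ⟪f x, f x⟫ ∂μ := by
  rw [L2_norm_sq, ← integral_const_mul]
  refine integral_mono_ae ((integrable_L2_norm_sq f).const_mul lo) (integrable_mul_inner hm f f) ?_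
  filter_upwards [hlo] with x hx
  rw [real_inner_self_eq_norm_sq]
  gcongr

theorem integrable_sq_mul_norm_sq {m : α → ℝ} (hm : MemLp m ∞ μ) (f : Lp E 2 μ) :
    Integrable (fun x => m x ^ 2 * ‖f x‖ ^ 2) μ := by
  have h1 : MemLp (fun x => ‖f x‖ ^ 2) 1 μ := memLp_one_iff_integrable.2 (integrable_L2_norm_sq f)
  have h2 : MemLp (fun x => m x ^ 2) ∞ μ := by
    simp_rw [sq]
    exact hm.mul (r := ∞) hm
  exact memLp_one_iff_integrable.1 (h1.mul h2)

/-- Young's inequality. The weight `m` stays with `f`, since dominated convergence is applied to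
`m² |f|²` with `f` fixed. -/
theorem integral_mul_inner_le {m : α → ℝ} (hm : MemLp m ∞ μ) {ε : ℝ} (hε : 0 < ε)
    (f g : Lp E 2 μ) : ∫ x, m x * ⟪f x, g x⟫ ∂μ ≤
      1 / (2 * ε) * ∫ x, m x ^ 2 * ‖f x‖ ^ 2 ∂μ + ε / 2 * ‖g‖ ^ 2 := by
  rw [L2_norm_sq g, ← integral_const_mul, ← integral_const_mul, ← integral_add
    ((integrable_sq_mul_norm_sq hm f).const_mul _) ((integrable_L2_norm_sq g).const_mul _)]
  refine integral_mono (integrable_mul_inner hm f g)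
    (((integrable_sq_mul_norm_sq hm f).const_mul _).add ((integrable_L2_norm_sq g).const_mul _))
    fun x => ?_
  have h1 : m x * ⟪f x, g x⟫ ≤ |m x| * ‖f x‖ * ‖g x‖ := by
    calc m x * ⟪f x, g x⟫ ≤ |m x * ⟪f x, g x⟫| := le_abs_self _
      _ = |m x| * |⟪f x, g x⟫| := abs_mul _ _
      _ ≤ |m x| * (‖f x‖ * ‖g x‖) := by gcongr; exact abs_real_inner_le_norm _ _
      _ = _ := by ring
  have h2 : 0 ≤ (|m x| * ‖f x‖ - ε * ‖g x‖) ^ 2 := sq_nonneg _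
  have h3 : (|m x| * ‖f x‖) ^ 2 = m x ^ 2 * ‖f x‖ ^ 2 := by rw [mul_pow, sq_abs]
  have h4 : 1 / (2 * ε) * (m x ^ 2 * ‖f x‖ ^ 2) + ε / 2 * ‖g x‖ ^ 2 - |m x| * ‖f x‖ * ‖g x‖ =
      (|m x| * ‖f x‖ - ε * ‖g x‖) ^ 2 / (2 * ε) := by
    rw [← h3]
    field_simp
    ring
  have h5 : 0 ≤ (|m x| * ‖f x‖ - ε * ‖g x‖) ^ 2 / (2 * ε) := by positivity
  change _ ≤ 1 / (2 * ε) * (m x ^ 2 * ‖f x‖ ^ 2) + ε / 2 * ‖g x‖ ^ 2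
  linarith

theorem tendsto_integral_sq_mul_norm_sq {m : ℕ → α → ℝ} {R : ℝ}
    (hm : ∀ n, AEStronglyMeasurable (m n) μ) (hR : ∀ n, ∀ᵐ x ∂μ, |m n x| ≤ R)
    (hlim : ∀ᵐ x ∂μ, Tendsto (fun n => m n x) atTop (𝓝 0)) (f : Lp E 2 μ) :
    Tendsto (fun n => ∫ x, m n x ^ 2 * ‖f x‖ ^ 2 ∂μ) atTop (𝓝 0) := by
  have h := tendsto_integral_of_dominated_convergence (μ := μ)
    (F := fun n x => m n x ^ 2 * ‖f x‖ ^ 2) (f := fun _ => (0 : ℝ))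
    (fun x => R ^ 2 * ‖f x‖ ^ 2) (fun n => ((hm n).pow 2).mul (integrable_L2_norm_sq f).1)
    ((integrable_L2_norm_sq f).const_mul _) (fun n => ?_) ?_
  · simpa using h
  · filter_upwards [hR n] with x hx
    rw [Real.norm_eq_abs, abs_of_nonneg (by positivity), ← sq_abs (m n x)]
    gcongr
  · filter_upwards [hlim] with x hx
    simpa using (hx.pow 2).mul_const (‖f x‖ ^ 2)

end Pairing

/-! ### The weak formulation -/

section WeakFormulation

/-- `a` is a measurable coefficient on `Ω` with values in `[lo, hi]` almost everywhere. -/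
structure IsCoefficient (Ω : Set Plane) (lo hi : ℝ) (a : Plane → ℝ) : Prop where
  aestronglyMeasurable : AEStronglyMeasurable a (volume.restrict Ω)
  ae_le : ∀ᵐ x ∂volume.restrict Ω, lo ≤ a x
  le_ae : ∀ᵐ x ∂volume.restrict Ω, a x ≤ hi

variable {Ω : Set Plane} {L : ℕ} {O : Fin L → Set Plane} {lo hi : ℝ} {a b : Plane → ℝ}

theorem IsCoefficient.memLp (ha : IsCoefficient Ω lo hi a) : MemLp a ∞ (volume.restrict Ω) := by
  refine memLp_top_of_bound ha.aestronglyMeasurable (max |lo| |hi|) ?_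
  filter_upwards [ha.ae_le, ha.le_ae] with x h1 h2
  exact abs_le_max_abs_abs h1 h2

/-- The map `(u, ∇u, g, U) ↦ g - U_l`, with values in `L²(∂Ω)`; here `U_l` is the constant
function, which is in `L²(∂Ω)` because the boundary has finite length. -/
noncomputable def jump (L : ℕ) [IsFiniteMeasure (surfaceMeasure Ω)] (l : Fin L) :
    StateSpace Ω L →L[ℝ] L2Bdry Ω :=
  trace - (ContinuousLinearMap.toSpanSingleton ℝ
    (indicatorConstLp 2 MeasurableSet.univ (measure_ne_top (surfaceMeasure Ω) _) (1 : ℝ))).comp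
      ((EuclideanSpace.proj l).comp vec)

theorem coeFn_jump [IsFiniteMeasure (surfaceMeasure Ω)] (l : Fin L) (p : StateSpace Ω L) :
    jump L l p =ᵐ[surfaceMeasure Ω] fun x => trace p x - vec p l := by
  set one : L2Bdry Ω :=
    indicatorConstLp 2 MeasurableSet.univ (measure_ne_top (surfaceMeasure Ω) _) (1 : ℝ) with hone
  have h1 : one =ᵐ[surfaceMeasure Ω] Set.univ.indicator fun _ => (1 : ℝ) := indicatorConstLp_coeFn
  have h : jump L l p = trace p - vec p l • one := rfl
  rw [h]
  filter_upwards [h1, Lp.coeFn_sub (trace p) (vec p l • one), Lp.coeFn_smul (vec p l) one]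
    with x e1 e2 e3
  rw [e2, Pi.sub_apply, e3, Pi.smul_apply, e1]
  simp

theorem memLp_indicator_one (hO : ∀ l, MeasurableSet (O l)) (l : Fin L) :
    MemLp ((O l).indicator fun _ => (1 : ℝ)) ∞ (surfaceMeasure Ω) := by
  refine memLp_top_of_bound (measurable_const.indicator (hO l)).aestronglyMeasurable 1 ?_
  refine ae_of_all _ fun x => ?_
  by_cases hx : x ∈ O l <;> simp [hx]

theorem setIntegral_jump_eq [IsFiniteMeasure (surfaceMeasure Ω)] (hO : ∀ l, MeasurableSet (O l))
    (l : Fin L) (p q : StateSpace Ω L) :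
    ∫ x, (O l).indicator (fun _ => (1 : ℝ)) x * ⟪jump L l p x, jump L l q x⟫ ∂(surfaceMeasure Ω) =
      ∫ x in O l, (trace p x - vec p l) * (trace q x - vec q l) ∂(surfaceMeasure Ω) := by
  rw [← integral_indicator (hO l)]
  refine integral_congr_ae ?_
  filter_upwards [coeFn_jump l p, coeFn_jump l q] with x hp hq
  rw [hp, hq]
  by_cases hx : x ∈ O l
  · rw [Set.indicator_of_mem hx, Set.indicator_of_mem hx, one_mul, real_inner_comm]
    rfl
  · rw [Set.indicator_of_notMem hx, Set.indicator_of_notMem hx, zero_mul]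

/-- The bilinear form `B` as a function of two elements of the state space. -/
noncomputable abbrev stateForm (O : Fin L → Set Plane) (a b : Plane → ℝ) (p q : StateSpace Ω L) :
    ℝ :=
  bilinForm Ω O a b (fn p) (grad p) (trace p) (vec p) (fn q) (grad q) (trace q) (vec q)

theorem stateForm_eq (p q : StateSpace Ω L) : stateForm O a b p q =
    (∫ x in Ω, a x * ⟪grad p x, grad q x⟫) + (∫ x in Ω, b x * ⟪fn p x, fn q x⟫) +
      ∑ l, (1 / 2 : ℝ) *
        ∫ x in O l, (trace p x - vec p l) * (trace q x - vec q l) ∂(surfaceMeasure Ω) := by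
  have h : ∀ x, b x * ⟪fn p x, fn q x⟫ = b x * (fn p x * fn q x) := fun x => by
    rw [real_inner_comm]; rfl
  simp_rw [h]
  rfl

theorem exists_stateForm_clm (hΩ : IsLipschitzDomain Ω) (hO : ∀ l, MeasurableSet (O l))
    (ha : IsCoefficient Ω lo hi a) (hb : IsCoefficient Ω lo hi b) :
    ∃ B : StateSpace Ω L →L[ℝ] StateSpace Ω L →L[ℝ] ℝ, ∀ p q, B p q = stateForm O a b p q := by
  have := isFiniteMeasure_surfaceMeasure hΩ
  obtain ⟨A, hA⟩ := exists_weightedPairing (E := Plane) ha.memLp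
  obtain ⟨B, hB⟩ := exists_weightedPairing (E := ℝ) hb.memLp
  choose S hS using fun l => exists_weightedPairing (E := ℝ) (memLp_indicator_one (Ω := Ω) hO l)
  refine ⟨A.bilinearComp grad grad + B.bilinearComp fn fn +
    ∑ l, (1 / 2 : ℝ) • (S l).bilinearComp (jump L l) (jump L l), fun p q => ?_⟩
  rw [stateForm_eq]
  simp only [add_apply, sum_apply, smul_apply, ContinuousLinearMap.bilinearComp_apply, hA, hB, hS,
    setIntegral_jump_eq hO, smul_eq_mul]

/-- The form is coercive on `H¹(Ω) ⊕ ℝ^L`, with a constant that depends on the coefficients only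
through their lower bound. The trace inequality controls `g`, and `U_l` is then controlled by
`g - U_l` and `g` on `O_l`, which has positive length. -/
theorem exists_coercive (hΩ : IsLipschitzDomain Ω)
    (hO_pos : ∀ l, 0 < surfaceMeasure Ω (O l)) (hlo : 0 < lo) :
    ∃ α > 0, ∀ hi a b, IsCoefficient Ω lo hi a → IsCoefficient Ω lo hi b →
      ∀ p ∈ sobolevSpace Ω L, α * ‖p‖ ^ 2 ≤ stateForm O a b p p := by
  have := isFiniteMeasure_surfaceMeasure hΩ
  obtain ⟨C, hC, htr⟩ := exists_norm_trace_le hΩ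
  set κ : ℝ := ∑ l, 1 / (surfaceMeasure Ω).real (O l) with hκ
  have hmpos : ∀ l, 0 < (surfaceMeasure Ω).real (O l) := fun l =>
    ENNReal.toReal_pos (hO_pos l).ne' (measure_ne_top _ _)
  have hκ0 : 0 ≤ κ := Finset.sum_nonneg fun l _ => (one_div_pos.2 (hmpos l)).le
  set D : ℝ := (1 + (1 + 2 * κ * L) * (2 * C ^ 2)) / lo + 4 * κ with hD
  have hDpos : 0 < D := by positivity
  refine ⟨1 / D, by positivity, fun hi a b ha hb p hp => ?_⟩
  set Q : Fin L → ℝ := fun l =>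
    ∫ x in O l, (trace p x - vec p l) * (trace p x - vec p l) ∂(surfaceMeasure Ω) with hQ
  have hQ0 : ∀ l, 0 ≤ Q l := fun l => integral_nonneg fun x => mul_self_nonneg _
  have hX1 := mul_norm_sq_le_integral ha.memLp ha.ae_le (grad p)
  have hX2 := mul_norm_sq_le_integral hb.memLp hb.ae_le (fn p)
  have hB : lo * (‖fn p‖ ^ 2 + ‖grad p‖ ^ 2) + 1 / 2 * ∑ l, Q l ≤ stateForm O a b p p := by
    have e : stateForm O a b p p = (∫ x in Ω, a x * ⟪grad p x, grad p x⟫) +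
        (∫ x in Ω, b x * ⟪fn p x, fn p x⟫) + 1 / 2 * ∑ l, Q l := by
      rw [stateForm_eq, Finset.mul_sum]
    rw [e]
    linarith
  have hg : ‖trace p‖ ^ 2 ≤ 2 * C ^ 2 * (‖fn p‖ ^ 2 + ‖grad p‖ ^ 2) := by
    have h1 := htr _ _ _ hp.2
    calc ‖trace p‖ ^ 2 ≤ (C * (‖fn p‖ + ‖grad p‖)) ^ 2 := by gcongr
      _ = C ^ 2 * (‖fn p‖ + ‖grad p‖) ^ 2 := mul_pow _ _ _
      _ ≤ C ^ 2 * (2 * (‖fn p‖ ^ 2 + ‖grad p‖ ^ 2)) := by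
          gcongr; nlinarith [sq_nonneg (‖fn p‖ - ‖grad p‖)]
      _ = _ := by ring
  have hU : ∀ l, vec p l ^ 2 ≤ κ * (2 * Q l + 2 * ‖trace p‖ ^ 2) := by
    intro l
    have hint1 : Integrable (fun x => (trace p x - vec p l) * (trace p x - vec p l))
        ((surfaceMeasure Ω).restrict (O l)) := by
      have h1 := (L2.integrable_inner (𝕜 := ℝ) (jump L l p) (jump L l p)).integrableOn (s := O l)
      refine Integrable.congr h1 (ae_restrict_of_ae ?_)
      filter_upwards [coeFn_jump l p] with x hx
      rw [hx]
      rfl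
    have hint2 := (integrable_L2_norm_sq (trace p)).integrableOn (s := O l)
    have h1 : (surfaceMeasure Ω).real (O l) * vec p l ^ 2 ≤ 2 * Q l + 2 * ‖trace p‖ ^ 2 := by
      calc (surfaceMeasure Ω).real (O l) * vec p l ^ 2
          = ∫ x in O l, vec p l ^ 2 ∂(surfaceMeasure Ω) := by simp
        _ ≤ ∫ x in O l, (2 * ((trace p x - vec p l) * (trace p x - vec p l)) +
              2 * ‖trace p x‖ ^ 2) ∂(surfaceMeasure Ω) := by
            refine integral_mono (integrable_const _) ((hint1.const_mul 2).add (hint2.const_mul 2))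
              fun x => ?_
            simp only [Real.norm_eq_abs, sq_abs]
            nlinarith [sq_nonneg (2 * trace p x - vec p l)]
        _ = 2 * Q l + 2 * ∫ x in O l, ‖trace p x‖ ^ 2 ∂(surfaceMeasure Ω) := by
            rw [integral_add (hint1.const_mul 2) (hint2.const_mul 2), integral_const_mul,
              integral_const_mul]
        _ ≤ 2 * Q l + 2 * ‖trace p‖ ^ 2 := by
            have := setIntegral_le_integral (s := O l) (integrable_L2_norm_sq (trace p))
              (ae_of_all _ fun x => sq_nonneg ‖trace p x‖)
            rw [L2_norm_sq (trace p)]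
            linarith
    have h2 : 1 / (surfaceMeasure Ω).real (O l) ≤ κ :=
      Finset.single_le_sum (f := fun l => 1 / (surfaceMeasure Ω).real (O l))
        (fun l _ => (one_div_pos.2 (hmpos l)).le) (Finset.mem_univ l)
    have h3 : 0 ≤ 2 * Q l + 2 * ‖trace p‖ ^ 2 := by have := hQ0 l; positivity
    calc vec p l ^ 2 = 1 / (surfaceMeasure Ω).real (O l) *
          ((surfaceMeasure Ω).real (O l) * vec p l ^ 2) := by
          have := (hmpos l).ne'
          field_simp
      _ ≤ 1 / (surfaceMeasure Ω).real (O l) * (2 * Q l + 2 * ‖trace p‖ ^ 2) := by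
          have := (one_div_pos.2 (hmpos l)).le
          gcongr
      _ ≤ κ * (2 * Q l + 2 * ‖trace p‖ ^ 2) := by gcongr
  have hUsum : ‖vec p‖ ^ 2 ≤ κ * (2 * ∑ l, Q l + 2 * (L * ‖trace p‖ ^ 2)) := by
    rw [EuclideanSpace.real_norm_sq_eq]
    refine (Finset.sum_le_sum fun l _ => hU l).trans (le_of_eq ?_)
    rw [← Finset.mul_sum, Finset.sum_add_distrib, ← Finset.mul_sum,
      Finset.sum_const, Finset.card_univ, Fintype.card_fin, nsmul_eq_mul]
    ring
  have hQs : 0 ≤ ∑ l, Q l := Finset.sum_nonneg fun l _ => hQ0 l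
  set X := ‖fn p‖ ^ 2 + ‖grad p‖ ^ 2 with hX
  have hX0 : 0 ≤ X := by positivity
  set s := ∑ l, Q l with hs
  have hβ : lo * X ≤ stateForm O a b p p := by linarith
  have hβ' : s ≤ 2 * stateForm O a b p p := by
    have : 0 ≤ lo * X := by positivity
    linarith
  have hnorm : ‖p‖ ^ 2 ≤ D * stateForm O a b p p := by
    rw [StateSpace.norm_sq_eq]
    have hgL : (1 + 2 * κ * L) * ‖trace p‖ ^ 2 ≤ (1 + 2 * κ * L) * (2 * C ^ 2 * X) := by gcongr
    have h1 : ‖fn p‖ ^ 2 + ‖grad p‖ ^ 2 + ‖trace p‖ ^ 2 + ‖vec p‖ ^ 2 ≤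
        (1 + (1 + 2 * κ * L) * (2 * C ^ 2)) * X + 2 * κ * s := by linarith
    have h2 : X ≤ stateForm O a b p p / lo := by
      rw [le_div_iff₀ hlo]; linarith
    calc _ ≤ (1 + (1 + 2 * κ * L) * (2 * C ^ 2)) * X + 2 * κ * s := h1
      _ ≤ (1 + (1 + 2 * κ * L) * (2 * C ^ 2)) * (stateForm O a b p p / lo) +
          2 * κ * (2 * stateForm O a b p p) := by gcongr
      _ = D * stateForm O a b p p := by rw [hD]; ring
  rw [one_div, inv_mul_le_iff₀ hDpos]
  exact hnorm

/-- The right-hand side `q ↦ -∑_l F_l V_l` of the weak formulation. -/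
noncomputable def load (Ω : Set Plane) (F : EuclideanSpace ℝ (Fin L)) : StateSpace Ω L →L[ℝ] ℝ :=
  -(innerSL ℝ F).comp vec

theorem load_apply (F : EuclideanSpace ℝ (Fin L)) (q : StateSpace Ω L) :
    load Ω F q = -∑ l, F l * vec q l := by
  simp [load, PiLp.inner_apply, mul_comm]

theorem isWeakSolution_iff {F : EuclideanSpace ℝ (Fin L)} {p : L2 Ω × EuclideanSpace ℝ (Fin L)} :
    IsWeakSolution Ω O a b F p ↔ ∃ q ∈ sobolevSpace Ω L, fn q = p.1 ∧ vec q = p.2 ∧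
      ∀ r ∈ sobolevSpace Ω L, stateForm O a b q r = load Ω F r := by
  constructor
  · rintro ⟨Du, g, h1, h2, h3⟩
    refine ⟨StateSpace.mk p.1 Du g p.2, ?_, fn_mk _ _ _ _, vec_mk _ _ _ _, fun r hr => ?_⟩
    · rw [mem_sobolevSpace, fn_mk, grad_mk, trace_mk]
      exact ⟨h1, h2⟩
    · rw [load_apply, stateForm, fn_mk, grad_mk, trace_mk, vec_mk]
      exact h3 _ _ _ _ hr.1 hr.2
  · rintro ⟨q, hq, h1, h2, h3⟩
    rw [mem_sobolevSpace, h1] at hq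
    refine ⟨grad q, trace q, hq.1, hq.2, fun v Dv h V hv hh => ?_⟩
    have hmem : StateSpace.mk v Dv h V ∈ sobolevSpace Ω L := by
      rw [mem_sobolevSpace, fn_mk, grad_mk, trace_mk]
      exact ⟨hv, hh⟩
    have := h3 _ hmem
    rwa [load_apply, stateForm, fn_mk, grad_mk, trace_mk, vec_mk, h1, h2] at this

theorem exists_state_solution (hΩ : IsLipschitzDomain Ω) (hO : ∀ l, MeasurableSet (O l))
    (hO_pos : ∀ l, 0 < surfaceMeasure Ω (O l)) (hlo : 0 < lo) (ha : IsCoefficient Ω lo hi a)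
    (hb : IsCoefficient Ω lo hi b) (F : EuclideanSpace ℝ (Fin L)) :
    ∃ q ∈ sobolevSpace Ω L, ∀ r ∈ sobolevSpace Ω L, stateForm O a b q r = load Ω F r := by
  obtain ⟨α, hα, hcoer⟩ := exists_coercive (O := O) hΩ hO_pos hlo
  obtain ⟨B, hB⟩ := exists_stateForm_clm hΩ hO ha hb
  simp_rw [← hB]
  exact exists_forall_eq_of_coercive (isClosed_sobolevSpace Ω L) hα
    (fun p hp => (hcoer hi a b ha hb p hp).trans_eq (hB p p).symm) (load Ω F)

theorem state_solution_unique (hΩ : IsLipschitzDomain Ω) (hO : ∀ l, MeasurableSet (O l))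
    (hO_pos : ∀ l, 0 < surfaceMeasure Ω (O l)) (hlo : 0 < lo) (ha : IsCoefficient Ω lo hi a)
    (hb : IsCoefficient Ω lo hi b) {F : EuclideanSpace ℝ (Fin L)} {q q' : StateSpace Ω L}
    (hq : q ∈ sobolevSpace Ω L) (hq' : q' ∈ sobolevSpace Ω L)
    (h : ∀ r ∈ sobolevSpace Ω L, stateForm O a b q r = load Ω F r)
    (h' : ∀ r ∈ sobolevSpace Ω L, stateForm O a b q' r = load Ω F r) : q = q' := by
  obtain ⟨α, hα, hcoer⟩ := exists_coercive (O := O) hΩ hO_pos hlo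
  obtain ⟨B, hB⟩ := exists_stateForm_clm hΩ hO ha hb
  simp_rw [← hB] at h h'
  exact eq_of_coercive hα (fun p hp => (hcoer hi a b ha hb p hp).trans_eq (hB p p).symm) hq hq' h h'

theorem existsUnique_isWeakSolution (hΩ : IsLipschitzDomain Ω) (hO : ∀ l, MeasurableSet (O l))
    (hO_pos : ∀ l, 0 < surfaceMeasure Ω (O l)) (hlo : 0 < lo) (ha : IsCoefficient Ω lo hi a)
    (hb : IsCoefficient Ω lo hi b) (F : EuclideanSpace ℝ (Fin L)) :
    ∃! p, IsWeakSolution Ω O a b F p := by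
  obtain ⟨q, hq, h⟩ := exists_state_solution (O := O) hΩ hO hO_pos hlo ha hb F
  refine ⟨(fn q, vec q), isWeakSolution_iff.2 ⟨q, hq, rfl, rfl, h⟩, fun p hp => ?_⟩
  obtain ⟨q', hq', h1, h2, h'⟩ := isWeakSolution_iff.1 hp
  obtain rfl := state_solution_unique hΩ hO hO_pos hlo ha hb hq hq' h h'
  exact Prod.ext h1.symm h2.symm

theorem isWeakSolution_solutionOperator (hΩ : IsLipschitzDomain Ω)
    (hO : ∀ l, MeasurableSet (O l)) (hO_pos : ∀ l, 0 < surfaceMeasure Ω (O l)) (hlo : 0 < lo)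
    (ha : IsCoefficient Ω lo hi a) (hb : IsCoefficient Ω lo hi b)
    (F : EuclideanSpace ℝ (Fin L)) :
    IsWeakSolution Ω O a b F (solutionOperator Ω O F a b) := by
  have h := (existsUnique_isWeakSolution hΩ hO hO_pos hlo ha hb F).exists
  rw [solutionOperator, dif_pos h]
  exact h.choose_spec

/-- The component `U` of the solution depends continuously on the coefficients, for pointwise
convergence within fixed positive bounds: by coercivity the difference of two solutions is bounded
by `∫ (a - aₙ)² |∇u|² + ∫ (b - bₙ)² u²`, which tends to `0` by dominated convergence. -/
theorem tendsto_solutionOperator (hΩ : IsLipschitzDomain Ω)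
    (hO : ∀ l, MeasurableSet (O l)) (hO_pos : ∀ l, 0 < surfaceMeasure Ω (O l)) (hlo : 0 < lo)
    {an bn : ℕ → Plane → ℝ} (han : ∀ n, IsCoefficient Ω lo hi (an n))
    (hbn : ∀ n, IsCoefficient Ω lo hi (bn n))
    (ha : IsCoefficient Ω lo hi a) (hb : IsCoefficient Ω lo hi b)
    (hal : ∀ᵐ x ∂volume.restrict Ω, Tendsto (fun n => an n x) atTop (𝓝 (a x)))
    (hbl : ∀ᵐ x ∂volume.restrict Ω, Tendsto (fun n => bn n x) atTop (𝓝 (b x)))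
    (F : EuclideanSpace ℝ (Fin L)) :
    Tendsto (fun n => (solutionOperator Ω O F (an n) (bn n)).2) atTop
      (𝓝 (solutionOperator Ω O F a b).2) := by
  obtain ⟨α, hα, hcoer⟩ := exists_coercive (O := O) hΩ hO_pos hlo
  obtain ⟨p, hp, -, hpU, hpB⟩ := isWeakSolution_iff.1
    (isWeakSolution_solutionOperator hΩ hO hO_pos hlo ha hb F)
  choose q hq hq1 hqU hqB using fun n => isWeakSolution_iff.1
    (isWeakSolution_solutionOperator hΩ hO hO_pos hlo (han n) (hbn n) F)
  set δ : ℕ → ℝ := fun n => (∫ x in Ω, (a x - an n x) ^ 2 * ‖grad p x‖ ^ 2) +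
    ∫ x in Ω, (b x - bn n x) ^ 2 * ‖fn p x‖ ^ 2 with hδ
  have hdiff : ∀ {a : Plane → ℝ} {an : ℕ → Plane → ℝ}, IsCoefficient Ω lo hi a →
      (∀ n, IsCoefficient Ω lo hi (an n)) →
      (∀ᵐ x ∂volume.restrict Ω, Tendsto (fun n => an n x) atTop (𝓝 (a x))) →
      (∀ n, AEStronglyMeasurable (fun x => a x - an n x) (volume.restrict Ω)) ∧
      (∀ n, ∀ᵐ x ∂volume.restrict Ω, |a x - an n x| ≤ hi - lo) ∧
      ∀ᵐ x ∂volume.restrict Ω, Tendsto (fun n => a x - an n x) atTop (𝓝 0) := by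
    intro a an ha han hal
    refine ⟨fun n => ha.1.sub (han n).1, fun n => ?_, ?_⟩
    · filter_upwards [ha.2, ha.3, (han n).2, (han n).3] with x h1 h2 h3 h4
      exact abs_le.2 ⟨by linarith, by linarith⟩
    · filter_upwards [hal] with x hx
      simpa using hx.const_sub (a x)
  obtain ⟨a1, a2, a3⟩ := hdiff ha han hal
  obtain ⟨b1, b2, b3⟩ := hdiff hb hbn hbl
  have hδ0 : Tendsto δ atTop (𝓝 0) := by
    rw [← add_zero (0 : ℝ)]
    exact (tendsto_integral_sq_mul_norm_sq a1 a2 a3 (grad p)).add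
      (tendsto_integral_sq_mul_norm_sq b1 b2 b3 (fn p))
  have hle : ∀ n, ‖vec (q n) - vec p‖ ^ 2 ≤ δ n / α ^ 2 := by
    intro n
    obtain ⟨B, hB⟩ := exists_stateForm_clm (O := O) hΩ hO ha hb
    obtain ⟨Bn, hBn⟩ := exists_stateForm_clm (O := O) hΩ hO (han n) (hbn n)
    set r := q n - p with hr
    have hrV : r ∈ sobolevSpace Ω L := sub_mem (hq n) hp
    have h1 := hcoer hi _ _ (han n) (hbn n) r hrV
    have h2 : stateForm O (an n) (bn n) r r =
        (∫ x in Ω, (a x - an n x) * ⟪grad p x, grad r x⟫) +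
          ∫ x in Ω, (b x - bn n x) * ⟪fn p x, fn r x⟫ := by
      have e1 : stateForm O (an n) (bn n) r r =
          stateForm O a b p r - stateForm O (an n) (bn n) p r := by
        rw [← hBn, ← hBn, hpB r hrV, ← hqB n r hrV, ← hBn, ← sub_apply, ← map_sub]
      rw [e1, stateForm_eq, stateForm_eq]
      simp_rw [sub_mul]
      rw [integral_sub (integrable_mul_inner ha.memLp _ _) (integrable_mul_inner (han n).memLp _ _),
        integral_sub (integrable_mul_inner hb.memLp _ _) (integrable_mul_inner (hbn n).memLp _ _)]
      ring
    have h3 := integral_mul_inner_le (ha.memLp.sub (han n).memLp) hα (grad p) (grad r)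
    have h4 := integral_mul_inner_le (hb.memLp.sub (hbn n).memLp) hα (fn p) (fn r)
    simp only [Pi.sub_apply] at h3 h4
    have h5 := StateSpace.norm_sq_eq r
    have h6 : α * ‖r‖ ^ 2 ≤ 1 / (2 * α) * δ n + α / 2 * ‖r‖ ^ 2 := by
      have h7 : 0 ≤ α / 2 * (‖trace r‖ ^ 2 + ‖vec r‖ ^ 2) := by positivity
      have h8 : α / 2 * ‖r‖ ^ 2 = α / 2 * ‖grad r‖ ^ 2 + α / 2 * ‖fn r‖ ^ 2 +
          α / 2 * (‖trace r‖ ^ 2 + ‖vec r‖ ^ 2) := by rw [h5]; ring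
      have h9 : 1 / (2 * α) * δ n = 1 / (2 * α) * (∫ x in Ω, (a x - an n x) ^ 2 * ‖grad p x‖ ^ 2) +
          1 / (2 * α) * ∫ x in Ω, (b x - bn n x) ^ 2 * ‖fn p x‖ ^ 2 := mul_add _ _ _
      linarith
    have h7 : ‖r‖ ^ 2 ≤ δ n / α ^ 2 := by
      rw [le_div_iff₀ (by positivity)]
      have h8 : α / 2 * ‖r‖ ^ 2 ≤ δ n / (2 * α) := by
        have : 1 / (2 * α) * δ n = δ n / (2 * α) := by ring
        linarith
      rw [le_div_iff₀ (by positivity)] at h8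
      linarith
    have h9 : ‖vec r‖ ^ 2 ≤ ‖r‖ ^ 2 := by
      rw [h5]; linarith [sq_nonneg ‖fn r‖, sq_nonneg ‖grad r‖, sq_nonneg ‖trace r‖]
    rw [← map_sub]
    exact h9.trans h7
  have hsq : Tendsto (fun n => ‖vec (q n) - vec p‖ ^ 2) atTop (𝓝 0) :=
    squeeze_zero (fun n => sq_nonneg _) hle (by simpa using hδ0.div_const (α ^ 2))
  have hnorm : Tendsto (fun n => ‖vec (q n) - vec p‖) atTop (𝓝 0) := by
    have := (Real.continuous_sqrt.tendsto 0).comp hsq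
    simpa [Function.comp_def, Real.sqrt_sq] using this
  simp_rw [← hqU, ← hpU]
  exact tendsto_iff_norm_sub_tendsto_zero.2 hnorm

end WeakFormulation

/-! ### Level-set maps and measurability of the forward map -/

section LevelSet

variable {Ω : Set Plane}

open Classical in
/-- The function `h ∘ u` on `Ω`, extended by `0`. -/
noncomputable def pullback (h : ℝ → ℝ) (u : C(closure Ω, ℝ)) (x : Plane) : ℝ :=
  if hx : x ∈ Ω then h (u ⟨x, subset_closure hx⟩) else 0

theorem pullback_of_mem (h : ℝ → ℝ) (u : C(closure Ω, ℝ)) {x : Plane} (hx : x ∈ Ω) :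
    pullback h u x = h (u ⟨x, subset_closure hx⟩) := dif_pos hx

theorem isCoefficient_pullback (hΩ : IsOpen Ω) {h : ℝ → ℝ} (hm : Measurable h) {lo hi : ℝ}
    (hlo : ∀ t, lo ≤ h t) (hhi : ∀ t, h t ≤ hi) (u : C(closure Ω, ℝ)) :
    IsCoefficient Ω lo hi (pullback h u) := by
  refine ⟨?_, ?_, ?_⟩
  · classical
    refine Measurable.aestronglyMeasurable ?_
    have h1 : Measurable fun x : Ω => h (u ⟨x, subset_closure x.2⟩) :=
      hm.comp (u.continuous.comp (by fun_prop)).measurable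
    have h2 : Measurable fun _ : (Ωᶜ : Set Plane) => (0 : ℝ) := measurable_const
    unfold pullback
    exact Measurable.dite h1 h2 hΩ.measurableSet
  · filter_upwards [ae_restrict_mem hΩ.measurableSet] with x hx
    rw [pullback_of_mem h u hx]
    exact hlo _
  · filter_upwards [ae_restrict_mem hΩ.measurableSet] with x hx
    rw [pullback_of_mem h u hx]
    exact hhi _

/-- The step function on `ℝ` with value `a i` on `[c i, c (i+1))`. The level-set map is the
composition with it. -/
noncomputable def stepFun {M : ℕ} (c : Fin (M + 1) → EReal) (a : Fin M → ℝ) (t : ℝ) : ℝ :=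
  ∑ i, if c i.castSucc ≤ (t : EReal) ∧ (t : EReal) < c i.succ then a i else 0

theorem levelSetMap_eq_pullback {M : ℕ} (c : Fin (M + 1) → EReal) (a : Fin M → ℝ)
    (u : C(closure Ω, ℝ)) : levelSetMap c a u = pullback (stepFun c a) u := by
  ext x
  by_cases hx : x ∈ Ω
  · rw [pullback_of_mem _ _ hx, levelSetMap, stepFun]
    refine Finset.sum_congr rfl fun i _ => ?_
    classical
    rw [Set.indicator_apply]
    refine if_congr ?_ rfl rfl
    exact ⟨fun ⟨_, h⟩ => h, fun h => ⟨hx, h⟩⟩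
  · rw [pullback, dif_neg hx, levelSetMap]
    refine Finset.sum_eq_zero fun i _ => Set.indicator_of_notMem ?_ _
    exact fun ⟨h, _⟩ => hx h

/-- A continuous function of `t` that decreases to the indicator of `[e, ∞)` as `n → ∞`. It equals
`1` on `[e, ∞)`, so that the limit has the right value at the threshold itself. -/
noncomputable def ramp (n : ℕ) (e : EReal) (t : ℝ) : ℝ :=
  if e = ⊥ then 1 else if e = ⊤ then 0 else max 0 (min 1 (1 + n * (t - e.toReal)))

theorem continuous_ramp (n : ℕ) (e : EReal) : Continuous (ramp n e) := by
  unfold ramp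
  split_ifs <;> fun_prop

theorem ramp_antitone (n : ℕ) (t : ℝ) : Antitone fun e => ramp n e t := by
  intro e e' h
  induction e with
  | bot =>
    by_cases h1 : e' = ⊥
    · simp [ramp, h1]
    · by_cases h2 : e' = ⊤ <;> simp [ramp, h1, h2]
  | top => simp [ramp, top_le_iff.1 h]
  | coe x =>
    induction e' with
    | bot => simp at h
    | top => simp [ramp]
    | coe y =>
      have hxy : x ≤ y := by exact_mod_cast h
      simp only [ramp, EReal.coe_ne_bot, EReal.coe_ne_top, if_false, EReal.toReal_coe]
      gcongr

theorem tendsto_ramp (e : EReal) (t : ℝ) :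
    Tendsto (fun n => ramp n e t) atTop (𝓝 (if e ≤ (t : EReal) then 1 else 0)) := by
  induction e with
  | bot => simp [ramp]
  | top => simp [ramp]
  | coe x =>
    simp only [ramp, EReal.coe_ne_bot, EReal.coe_ne_top, if_false, EReal.toReal_coe,
      EReal.coe_le_coe_iff]
    split_ifs with h
    · refine tendsto_const_nhds.congr fun n => ?_
      have : 0 ≤ (n : ℝ) * (t - x) := mul_nonneg (Nat.cast_nonneg _) (sub_nonneg.2 h)
      rw [min_eq_left (by linarith), max_eq_right zero_le_one]
    · obtain ⟨N, hN⟩ := exists_nat_gt (1 / (x - t))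
      have hpos : 0 < x - t := sub_pos.2 (not_le.1 h)
      refine tendsto_const_nhds.congr' ?_
      filter_upwards [eventually_ge_atTop N] with n hn
      have h1 : 1 < (N : ℝ) * (x - t) := (div_lt_iff₀ hpos).1 hN
      have h2 : (N : ℝ) * (x - t) ≤ n * (x - t) := by gcongr
      have h3 : 1 + (n : ℝ) * (t - x) ≤ 0 := by nlinarith
      rw [max_eq_left ((min_le_right _ _).trans h3)]

theorem sum_castSucc_sub_succ {M : ℕ} (f : Fin (M + 1) → ℝ) :
    ∑ i : Fin M, (f i.castSucc - f i.succ) = f 0 - f (Fin.last M) := by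
  rw [Finset.sum_sub_distrib]
  linarith [Fin.sum_univ_castSucc f, Fin.sum_univ_succ f]

/-- Continuous approximations of `stepFun`. Their values are convex combinations of the `a i`. -/
noncomputable def stepApprox {M : ℕ} (c : Fin (M + 1) → EReal) (a : Fin M → ℝ) (n : ℕ) (t : ℝ) :
    ℝ :=
  ∑ i, a i * (ramp n (c i.castSucc) t - ramp n (c i.succ) t)

theorem continuous_stepApprox {M : ℕ} (c : Fin (M + 1) → EReal) (a : Fin M → ℝ) (n : ℕ) :
    Continuous (stepApprox c a n) := by
  unfold stepApprox
  exact continuous_finsetSum _ fun i _ =>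
    continuous_const.mul ((continuous_ramp n _).sub (continuous_ramp n _))

section

variable {M : ℕ} {c : Fin (M + 1) → EReal} {a : Fin M → ℝ} {lo hi : ℝ}

theorem stepApprox_mem_Icc (hc : Monotone c) (h0 : c 0 = ⊥) (h1 : c (Fin.last M) = ⊤)
    (ha : ∀ i, a i ∈ Set.Icc lo hi) (n : ℕ) (t : ℝ) : stepApprox c a n t ∈ Set.Icc lo hi := by
  have hw : ∀ i : Fin M, 0 ≤ ramp n (c i.castSucc) t - ramp n (c i.succ) t := fun i =>
    sub_nonneg.2 (ramp_antitone n t (hc (Fin.castSucc_lt_succ).le))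
  have hsum : ∑ i : Fin M, (ramp n (c i.castSucc) t - ramp n (c i.succ) t) = 1 := by
    rw [sum_castSucc_sub_succ fun i => ramp n (c i) t, h0, h1]
    simp [ramp]
  constructor
  · calc lo = ∑ i : Fin M, lo * (ramp n (c i.castSucc) t - ramp n (c i.succ) t) := by
          rw [← Finset.mul_sum, hsum, mul_one]
      _ ≤ _ := Finset.sum_le_sum fun i _ => mul_le_mul_of_nonneg_right (ha i).1 (hw i)
  · calc _ ≤ ∑ i : Fin M, hi * (ramp n (c i.castSucc) t - ramp n (c i.succ) t) :=
          Finset.sum_le_sum fun i _ => mul_le_mul_of_nonneg_right (ha i).2 (hw i)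
      _ = hi := by rw [← Finset.mul_sum, hsum, mul_one]

theorem tendsto_stepApprox (hc : Monotone c) (t : ℝ) :
    Tendsto (fun n => stepApprox c a n t) atTop (𝓝 (stepFun c a t)) := by
  refine tendsto_finsetSum _ fun i _ => ?_
  have h := ((tendsto_ramp (c i.castSucc) t).sub (tendsto_ramp (c i.succ) t)).const_mul (a i)
  convert h using 2
  have hle : c i.castSucc ≤ c i.succ := hc (Fin.castSucc_lt_succ).le
  by_cases e1 : c i.succ ≤ (t : EReal)
  · have e2 : c i.castSucc ≤ (t : EReal) := hle.trans e1
    simp [e1, e2]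
  · by_cases e2 : c i.castSucc ≤ (t : EReal)
    · simp [e1, e2, not_le.1 e1]
    · simp [e1, e2]

theorem measurable_stepFun (hc : Monotone c) : Measurable (stepFun c a) :=
  measurable_of_tendsto_metrizable (fun n => (continuous_stepApprox c a n).measurable)
    (tendsto_pi_nhds.2 fun t => tendsto_stepApprox hc t)

theorem stepFun_mem_Icc (hc : Monotone c) (h0 : c 0 = ⊥) (h1 : c (Fin.last M) = ⊤)
    (ha : ∀ i, a i ∈ Set.Icc lo hi) (t : ℝ) : stepFun c a t ∈ Set.Icc lo hi :=
  isClosed_Icc.mem_of_tendsto (tendsto_stepApprox hc t)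
    (Eventually.of_forall fun n => stepApprox_mem_Icc hc h0 h1 ha n t)

/-- Common positive bounds for the values of both coefficients. With no values at all (`M = N = 0`)
there is nothing to bound, so minima and maxima are avoided. -/
theorem exists_pos_bounds {M N : ℕ} {a : Fin M → ℝ} (ha : ∀ i, 0 < a i) {b : Fin N → ℝ}
    (hb : ∀ i, 0 < b i) :
    ∃ lo hi : ℝ, 0 < lo ∧ (∀ i, a i ∈ Set.Icc lo hi) ∧ ∀ i, b i ∈ Set.Icc lo hi := by
  have key : ∀ {M : ℕ} {a : Fin M → ℝ}, (∀ i, 0 < a i) →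
      ∃ lo hi : ℝ, 0 < lo ∧ ∀ i, a i ∈ Set.Icc lo hi := by
    intro M a ha
    have h1 : ∀ i, 0 ≤ 1 / a i := fun i => (one_div_pos.2 (ha i)).le
    have hpos : 0 < 1 + ∑ i, 1 / a i := by
      have := Finset.sum_nonneg fun i (_ : i ∈ Finset.univ) => h1 i
      linarith
    refine ⟨1 / (1 + ∑ i, 1 / a i), ∑ i, a i, one_div_pos.2 hpos, fun i => ⟨?_, ?_⟩⟩
    · rw [one_div_le hpos (ha i)]
      have := Finset.single_le_sum (f := fun i => 1 / a i) (fun i _ => h1 i) (Finset.mem_univ i)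
      linarith
    · exact Finset.single_le_sum (f := a) (fun i _ => (ha i).le) (Finset.mem_univ i)
  obtain ⟨l, h, hl, h1⟩ := key ha
  obtain ⟨l', h', hl', h1'⟩ := key hb
  exact ⟨min l l', max h h', lt_min hl hl',
    fun i => ⟨(min_le_left _ _).trans (h1 i).1, (h1 i).2.trans (le_max_left _ _)⟩,
    fun i => ⟨(min_le_right _ _).trans (h1' i).1, (h1' i).2.trans (le_max_right _ _)⟩⟩

end

section Forward

variable {L J : ℕ} {O : Fin L → Set Plane} {lo hi : ℝ}

/-- The potentials on all the boundary elements for all the flux patterns, as a function of the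
two coefficients. -/
noncomputable def potentials (Ω : Set Plane) (O : Fin L → Set Plane)
    (F : Fin J → EuclideanSpace ℝ (Fin L)) (a b : Plane → ℝ) : Data L J :=
  WithLp.toLp 2 fun k => (solutionOperator Ω O (F k.2) a b).2 k.1

theorem tendsto_potentials (hΩ : IsLipschitzDomain Ω)
    (hO : ∀ l, MeasurableSet (O l)) (hO_pos : ∀ l, 0 < surfaceMeasure Ω (O l)) (hlo : 0 < lo)
    {an bn : ℕ → Plane → ℝ} {a b : Plane → ℝ} (han : ∀ n, IsCoefficient Ω lo hi (an n))
    (hbn : ∀ n, IsCoefficient Ω lo hi (bn n))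
    (ha : IsCoefficient Ω lo hi a) (hb : IsCoefficient Ω lo hi b)
    (hal : ∀ x ∈ Ω, Tendsto (fun n => an n x) atTop (𝓝 (a x)))
    (hbl : ∀ x ∈ Ω, Tendsto (fun n => bn n x) atTop (𝓝 (b x)))
    (F : Fin J → EuclideanSpace ℝ (Fin L)) :
    Tendsto (fun n => potentials Ω O F (an n) (bn n)) atTop (𝓝 (potentials Ω O F a b)) := by
  refine ((PiLp.continuous_toLp 2 _).tendsto _).comp (tendsto_pi_nhds.2 fun k => ?_)
  have h := tendsto_solutionOperator hΩ hO hO_pos hlo han hbn ha hb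
    (ae_restrict_of_forall_mem hΩ.isOpen.measurableSet hal)
    (ae_restrict_of_forall_mem hΩ.isOpen.measurableSet hbl) (F k.2)
  exact ((EuclideanSpace.proj (𝕜 := ℝ) k.1).continuous.tendsto _).comp h

/-- For continuous level functions in place of step functions the forward map is continuous. -/
theorem continuous_potentials_pullback (hΩ : IsLipschitzDomain Ω)
    (hO : ∀ l, MeasurableSet (O l)) (hO_pos : ∀ l, 0 < surfaceMeasure Ω (O l)) (hlo : 0 < lo)
    {h k : ℝ → ℝ} (hh : Continuous h) (hk : Continuous k) (hhm : ∀ t, h t ∈ Set.Icc lo hi)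
    (hkm : ∀ t, k t ∈ Set.Icc lo hi) (F : Fin J → EuclideanSpace ℝ (Fin L)) :
    Continuous fun u : C(closure Ω, ℝ) × C(closure Ω, ℝ) =>
      potentials Ω O F (pullback h u.1) (pullback k u.2) := by
  have : LocallyCompactSpace (closure Ω) :=
    isClosed_closure.isClosedEmbedding_subtypeVal.locallyCompactSpace
  refine continuous_iff_seqContinuous.2 fun u v huv => ?_
  have h1 : ∀ w : C(closure Ω, ℝ), IsCoefficient Ω lo hi (pullback h w) :=
    isCoefficient_pullback hΩ.isOpen hh.measurable (fun t => (hhm t).1) fun t => (hhm t).2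
  have h2 : ∀ w : C(closure Ω, ℝ), IsCoefficient Ω lo hi (pullback k w) :=
    isCoefficient_pullback hΩ.isOpen hk.measurable (fun t => (hkm t).1) fun t => (hkm t).2
  refine tendsto_potentials hΩ hO hO_pos hlo (fun n => h1 _) (fun n => h2 _) (h1 _) (h2 _)
    (fun x hx => ?_) (fun x hx => ?_) F
  · simp_rw [pullback_of_mem _ _ hx]
    have hc : Continuous fun w : C(closure Ω, ℝ) × C(closure Ω, ℝ) =>
        h (w.1 ⟨x, subset_closure hx⟩) := hh.comp ((continuous_eval_const _).comp continuous_fst)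
    exact (hc.tendsto v).comp huv
  · simp_rw [pullback_of_mem _ _ hx]
    have hc : Continuous fun w : C(closure Ω, ℝ) × C(closure Ω, ℝ) =>
        k (w.2 ⟨x, subset_closure hx⟩) := hk.comp ((continuous_eval_const _).comp continuous_snd)
    exact (hc.tendsto v).comp huv

variable {M N : ℕ} {c : Fin (M + 1) → EReal} {a : Fin M → ℝ} {d : Fin (N + 1) → EReal}
  {b : Fin N → ℝ}

/-- The forward map is measurable, being the pointwise limit of the continuous maps obtained from
the continuous approximations of the two step functions. -/
theorem measurable_forwardMap (hΩ : IsLipschitzDomain Ω)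
    (hO : ∀ l, MeasurableSet (O l)) (hO_pos : ∀ l, 0 < surfaceMeasure Ω (O l))
    (F : Fin J → EuclideanSpace ℝ (Fin L)) (hc : StrictMono c) (hc0 : c 0 = ⊥)
    (hc1 : c (Fin.last M) = ⊤) (ha : ∀ i, 0 < a i) (hd : StrictMono d) (hd0 : d 0 = ⊥)
    (hd1 : d (Fin.last N) = ⊤) (hb : ∀ i, 0 < b i)
    [MeasurableSpace C(closure Ω, ℝ)] [BorelSpace C(closure Ω, ℝ)] :
    Measurable (forwardMap Ω O F c a d b) := by
  have : LocallyCompactSpace (closure Ω) :=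
    isClosed_closure.isClosedEmbedding_subtypeVal.locallyCompactSpace
  obtain ⟨lo, hi, hlo, ha', hb'⟩ := exists_pos_bounds ha hb
  have hA := stepApprox_mem_Icc hc.monotone hc0 hc1 ha'
  have hB := stepApprox_mem_Icc hd.monotone hd0 hd1 hb'
  have hA' := stepFun_mem_Icc hc.monotone hc0 hc1 ha'
  have hB' := stepFun_mem_Icc hd.monotone hd0 hd1 hb'
  refine measurable_of_tendsto_metrizable (fun n => (continuous_potentials_pullback hΩ hO hO_pos hlo
    (continuous_stepApprox c a n) (continuous_stepApprox d b n) (hA n) (hB n) F).measurable)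
    (tendsto_pi_nhds.2 fun u => ?_)
  have e : forwardMap Ω O F c a d b u =
      potentials Ω O F (pullback (stepFun c a) u.1) (pullback (stepFun d b) u.2) := by
    rw [← levelSetMap_eq_pullback, ← levelSetMap_eq_pullback]
    rfl
  rw [e]
  refine tendsto_potentials hΩ hO hO_pos hlo
    (fun n => isCoefficient_pullback hΩ.isOpen (continuous_stepApprox c a n).measurable
      (fun t => (hA n t).1) (fun t => (hA n t).2) _)
    (fun n => isCoefficient_pullback hΩ.isOpen (continuous_stepApprox d b n).measurable
      (fun t => (hB n t).1) (fun t => (hB n t).2) _)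
    (isCoefficient_pullback hΩ.isOpen (measurable_stepFun hc.monotone)
      (fun t => (hA' t).1) (fun t => (hA' t).2) _)
    (isCoefficient_pullback hΩ.isOpen (measurable_stepFun hd.monotone)
      (fun t => (hB' t).1) (fun t => (hB' t).2) _) (fun x hx => ?_) (fun x hx => ?_) F
  · simp_rw [pullback_of_mem _ _ hx]
    exact tendsto_stepApprox hc.monotone _
  · simp_rw [pullback_of_mem _ _ hx]
    exact tendsto_stepApprox hd.monotone _

theorem existsUnique_isWeakSolution_levelSetMap (hΩ : IsLipschitzDomain Ω)
    (hO : ∀ l, MeasurableSet (O l)) (hO_pos : ∀ l, 0 < surfaceMeasure Ω (O l))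
    (F : EuclideanSpace ℝ (Fin L)) (hc : StrictMono c) (hc0 : c 0 = ⊥)
    (hc1 : c (Fin.last M) = ⊤) (ha : ∀ i, 0 < a i) (hd : StrictMono d) (hd0 : d 0 = ⊥)
    (hd1 : d (Fin.last N) = ⊤) (hb : ∀ i, 0 < b i) (u₁ u₂ : C(closure Ω, ℝ)) :
    ∃! p, IsWeakSolution Ω O (levelSetMap c a u₁) (levelSetMap d b u₂) F p := by
  obtain ⟨lo, hi, hlo, ha', hb'⟩ := exists_pos_bounds ha hb
  have hA' := stepFun_mem_Icc hc.monotone hc0 hc1 ha'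
  have hB' := stepFun_mem_Icc hd.monotone hd0 hd1 hb'
  rw [levelSetMap_eq_pullback, levelSetMap_eq_pullback]
  exact existsUnique_isWeakSolution hΩ hO hO_pos hlo
    (isCoefficient_pullback hΩ.isOpen (measurable_stepFun hc.monotone)
      (fun t => (hA' t).1) (fun t => (hA' t).2) _)
    (isCoefficient_pullback hΩ.isOpen (measurable_stepFun hd.monotone)
      (fun t => (hB' t).1) (fun t => (hB' t).2) _) F

end Forward

end LevelSet

/-! ### The density of the noise -/

section GaussianDensity

variable {ι : Type*} [Fintype ι]

/-- The standard Gaussian measure has Lebesgue density proportional to `exp(-|x|² / 2)`, by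
comparison of characteristic functions. -/
theorem exists_stdGaussian_eq_withDensity : ∃ κ : ℝ≥0∞, stdGaussian (EuclideanSpace ℝ ι) =
    κ • (volume : Measure (EuclideanSpace ℝ ι)).withDensity
      fun x => ENNReal.ofReal (Real.exp (-(1 / 2) * ‖x‖ ^ 2)) := by
  set w : EuclideanSpace ℝ ι → ℝ := fun x => Real.exp (-(1 / 2) * ‖x‖ ^ 2) with hw
  have hwm : Measurable w := by fun_prop
  have hw0 : ∀ x, 0 ≤ w x := fun x => (Real.exp_pos _).le
  set ν := (volume : Measure (EuclideanSpace ℝ ι)).withDensity fun x => ENNReal.ofReal (w x) with hν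
  have hint : Integrable w := by
    have h := GaussianFourier.integrable_cexp_neg_mul_sq_norm_add (V := EuclideanSpace ℝ ι)
      (b := (1 / 2 : ℂ)) (by norm_num) 0 0
    refine h.norm.congr (ae_of_all _ fun x => ?_)
    change ‖Complex.exp (-(1 / 2) * (‖x‖ : ℂ) ^ 2 + 0 * _)‖ = Real.exp (-(1 / 2) * ‖x‖ ^ 2)
    have hx : (-(1 / 2) * (‖x‖ : ℂ) ^ 2) = ((-(1 / 2) * ‖x‖ ^ 2 : ℝ) : ℂ) := by push_cast; ring
    rw [zero_mul, add_zero, hx, ← Complex.ofReal_exp, Complex.norm_of_nonneg (Real.exp_pos _).le]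
  have hfin : IsFiniteMeasure ν := isFiniteMeasure_withDensity_ofReal hint.2
  set K : ℂ := (Real.pi / (1 / 2 : ℂ)) ^ (Module.finrank ℝ (EuclideanSpace ℝ ι) / 2 : ℂ) with hK
  have hchar : ∀ t, charFun ν t = K * Complex.exp (-‖t‖ ^ 2 / 2) := by
    intro t
    have h := GaussianFourier.integral_cexp_neg_mul_sq_norm_add (V := EuclideanSpace ℝ ι)
      (b := (1 / 2 : ℂ)) (by norm_num) Complex.I t
    rw [charFun_apply, hν, integral_withDensity_eq_integral_toReal_smul
      (by fun_prop) (ae_of_all _ fun _ => ENNReal.ofReal_lt_top)]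
    rw [hK]
    convert h using 2
    · ext x
      rw [ENNReal.toReal_ofReal (hw0 x), Complex.real_smul, hw, Complex.ofReal_exp,
        ← Complex.exp_add]
      congr 1
      push_cast
      rw [real_inner_comm]
      ring
    · congr 1
      rw [Complex.I_sq]
      ring
  have hK1 : K = ν.real Set.univ := by
    have := hchar 0
    rw [charFun_zero] at this
    simpa using this.symm
  have hKne : K ≠ 0 := by
    rw [hK, Ne, Complex.cpow_eq_zero_iff, not_and_or]
    left
    simp [Real.pi_ne_zero]
  have hν0 : ν Set.univ ≠ 0 := by
    intro h
    apply hKne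
    rw [hK1, Measure.real, h]
    simp
  refine ⟨(ν Set.univ)⁻¹, ?_⟩
  have : IsFiniteMeasure ((ν Set.univ)⁻¹ • ν) :=
    Measure.smul_finite _ (ENNReal.inv_ne_top.2 hν0)
  refine Measure.ext_of_charFun ?_
  ext t
  rw [charFun_stdGaussian, charFun_apply, integral_smul_measure, ← charFun_apply, hchar, hK1,
    Complex.real_smul, ENNReal.toReal_inv]
  rw [Measure.real, ← mul_assoc, Complex.ofReal_inv, inv_mul_cancel₀, one_mul]
  exact_mod_cast (ENNReal.toReal_pos hν0 (measure_ne_top _ _)).ne'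

variable [DecidableEq ι]

theorem continuous_weightedNorm (Γ : Matrix ι ι ℝ) : Continuous (weightedNorm Γ) := by
  unfold weightedNorm
  fun_prop

/-- The noise `N(0, Γ)` has Lebesgue density proportional to `exp(-|x|_Γ² / 2)`. -/
theorem exists_lintegral_multivariateGaussian {Γ : Matrix ι ι ℝ} (hΓ : Γ.PosDef) :
    ∃ κ : ℝ≥0∞, ∀ f : EuclideanSpace ℝ ι → ℝ≥0∞, Measurable f →
      ∫⁻ x, f x ∂(multivariateGaussian 0 Γ) =
        κ * ∫⁻ x, f x * ENNReal.ofReal (Real.exp (-(1 / 2 * weightedNorm Γ x ^ 2))) := by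
  obtain ⟨κ, hκ⟩ := exists_stdGaussian_eq_withDensity (ι := ι)
  set S := CFC.sqrt Γ with hS
  have hSS : S * S = Γ := CFC.sqrt_mul_sqrt_self Γ hΓ.posSemidef.nonneg
  have hdet : IsUnit S.det := by
    have h1 : IsUnit Γ.det := (Matrix.isUnit_iff_isUnit_det _).1 hΓ.isUnit
    rw [← hSS, Matrix.det_mul] at h1
    exact isUnit_of_mul_isUnit_left h1
  set A := Matrix.toEuclideanCLM (𝕜 := ℝ) S with hA
  set A' := Matrix.toEuclideanCLM (𝕜 := ℝ) S⁻¹ with hA'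
  have hA'A : ∀ x, A' (A x) = x := fun x => by
    have : A' * A = 1 := by rw [hA, hA', ← map_mul, Matrix.nonsing_inv_mul _ hdet, map_one]
    exact congrArg (fun T : EuclideanSpace ℝ ι →L[ℝ] EuclideanSpace ℝ ι => T x) this
  have hAdet : LinearMap.det (A : EuclideanSpace ℝ ι →ₗ[ℝ] EuclideanSpace ℝ ι) ≠ 0 := by
    have hcomp : (A' : EuclideanSpace ℝ ι →ₗ[ℝ] EuclideanSpace ℝ ι) ∘ₗ A = LinearMap.id :=
      LinearMap.ext hA'A
    have := congrArg LinearMap.det hcomp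
    rw [LinearMap.det_comp, LinearMap.det_id] at this
    exact right_ne_zero_of_mul_eq_one this
  have hmap := Measure.map_linearMap_addHaar_eq_smul_addHaar
    (volume : Measure (EuclideanSpace ℝ ι)) hAdet
  set δ : ℝ≥0∞ :=
    ENNReal.ofReal |(LinearMap.det (A : EuclideanSpace ℝ ι →ₗ[ℝ] EuclideanSpace ℝ ι))⁻¹|
  change Measure.map A volume = _ at hmap
  refine ⟨κ * δ, fun f hf => ?_⟩
  have hAm : Measurable A := A.continuous.measurable
  have hfA : Measurable fun x => f (A x) := hf.comp hAm
  have hwm : Measurable fun x => f x *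
      ENNReal.ofReal (Real.exp (-(1 / 2 * weightedNorm Γ x ^ 2))) := by
    have := (continuous_weightedNorm Γ).measurable
    fun_prop
  simp only [multivariateGaussian, zero_add]
  rw [lintegral_map hf hAm, hκ, lintegral_smul_measure,
    lintegral_withDensity_eq_lintegral_mul _ (by fun_prop) hfA, smul_eq_mul, mul_assoc κ δ,
    ← smul_eq_mul δ,
    ← lintegral_smul_measure, ← hmap]
  rw [lintegral_map hwm hAm]
  congr 1
  refine lintegral_congr fun x => ?_
  have hx : weightedNorm Γ (A x) = ‖x‖ := congrArg norm (hA'A x)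
  rw [Pi.mul_apply, hx, mul_comm, neg_mul]

theorem posDef_noiseCov {L : ℕ} (J : ℕ) {Γ₀ : Matrix (Fin L) (Fin L) ℝ} (h : Γ₀.PosDef) :
    (noiseCov J Γ₀).PosDef := by
  rw [noiseCov, ← Matrix.kronecker_one]
  exact h.kronecker Matrix.PosDef.one

theorem weightedNorm_nonneg (Γ : Matrix ι ι ℝ) (y : EuclideanSpace ℝ ι) : 0 ≤ weightedNorm Γ y :=
  norm_nonneg _

theorem abs_weightedNorm_sub_le (Γ : Matrix ι ι ℝ) (y y' : EuclideanSpace ℝ ι) :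
    |weightedNorm Γ y - weightedNorm Γ y'| ≤ weightedNorm Γ (y - y') := by
  unfold weightedNorm
  rw [map_sub]
  exact abs_norm_sub_norm_le _ _

theorem weightedNorm_sub_le (Γ : Matrix ι ι ℝ) (y y' : EuclideanSpace ℝ ι) :
    weightedNorm Γ (y - y') ≤ weightedNorm Γ y + weightedNorm Γ y' := by
  unfold weightedNorm
  rw [map_sub]
  exact norm_sub_le _ _

end GaussianDensity

/-! ### Bayes' theorem and the Hellinger distance -/

section Bayes

theorem abs_exp_neg_sq_sub_le (s t : ℝ) :
    |Real.exp (-(s ^ 2 / 4)) - Real.exp (-(t ^ 2 / 4))| ≤ |s - t| := by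
  have hd : ∀ x ∈ (Set.univ : Set ℝ), HasDerivWithinAt (fun x : ℝ => Real.exp (-(x ^ 2 / 4)))
      (Real.exp (-(x ^ 2 / 4)) * (-(x / 2))) Set.univ x := by
    intro x _
    refine HasDerivAt.hasDerivWithinAt ?_
    refine (((hasDerivAt_pow 2 x).div_const 4).neg.exp).congr_deriv ?_
    norm_num
    ring
  have hb : ∀ x ∈ (Set.univ : Set ℝ), ‖Real.exp (-(x ^ 2 / 4)) * (-(x / 2))‖ ≤ 1 := by
    intro x _
    rw [Real.norm_eq_abs, abs_mul, abs_of_pos (Real.exp_pos _), Real.exp_neg,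
      inv_mul_le_iff₀ (Real.exp_pos _), mul_one]
    have h1 := Real.add_one_le_exp (x ^ 2 / 4)
    refine le_trans ?_ h1
    rw [abs_le]
    constructor <;> nlinarith [sq_nonneg (x - 1), sq_nonneg (x + 1)]
  have h := convex_univ.norm_image_sub_le_of_norm_hasDerivWithin_le hd hb (Set.mem_univ t)
    (Set.mem_univ s)
  simpa using h

section Potential

variable {X ι : Type*} [Fintype ι] [DecidableEq ι] {Γ : Matrix ι ι ℝ} {G : X → EuclideanSpace ℝ ι}

theorem potential_nonneg (u : X) (y : EuclideanSpace ℝ ι) : 0 ≤ potential Γ G u y := by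
  unfold potential
  positivity

/-- The square root of the likelihood is `1`-Lipschitz in the data. -/
theorem abs_exp_half_potential_sub_le (u : X) (y y' : EuclideanSpace ℝ ι) :
    |Real.exp (-(potential Γ G u y / 2)) - Real.exp (-(potential Γ G u y' / 2))| ≤
      weightedNorm Γ (y - y') := by
  have h := abs_exp_neg_sq_sub_le (weightedNorm Γ (y - G u)) (weightedNorm Γ (y' - G u))
  have e : ∀ z, potential Γ G u z / 2 = weightedNorm Γ (z - G u) ^ 2 / 4 := fun z => by
    rw [potential]; ring
  rw [e, e]
  refine h.trans ((abs_weightedNorm_sub_le Γ _ _).trans (le_of_eq ?_))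
  rw [sub_sub_sub_cancel_right]

end Potential

variable {X ι : Type*} [MeasurableSpace X] [Fintype ι] [DecidableEq ι] {μ0 : Measure X}
  [IsProbabilityMeasure μ0] {Γ : Matrix ι ι ℝ} {G : X → EuclideanSpace ℝ ι}

theorem measurable_potential (hG : Measurable G) :
    Measurable fun p : EuclideanSpace ℝ ι × X => potential Γ G p.2 p.1 := by
  unfold potential
  have h := (continuous_weightedNorm Γ).measurable.comp
    (measurable_fst.sub (hG.comp measurable_snd) : Measurable
      fun p : EuclideanSpace ℝ ι × X => p.1 - G p.2)
  exact (h.pow_const 2).const_mul _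

theorem measurable_likelihood (hG : Measurable G) :
    Measurable fun p : EuclideanSpace ℝ ι × X => Real.exp (-potential Γ G p.2 p.1) :=
  Real.measurable_exp.comp (measurable_potential hG).neg

theorem measurable_likelihood_right (hG : Measurable G) (y : EuclideanSpace ℝ ι) :
    Measurable fun u => Real.exp (-potential Γ G u y) := by
  have h : Measurable fun u : X => (y, u) := measurable_prodMk_left
  have h' := (measurable_likelihood (Γ := Γ) hG).comp h
  exact h'

theorem integrable_likelihood (hG : Measurable G) (y : EuclideanSpace ℝ ι) :
    Integrable (fun u => Real.exp (-potential Γ G u y)) μ0 := by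
  refine Integrable.of_bound (measurable_likelihood_right hG y).aestronglyMeasurable 1
    (ae_of_all _ fun u => ?_)
  rw [Real.norm_eq_abs, abs_of_pos (Real.exp_pos _), Real.exp_le_one_iff]
  exact neg_nonpos.2 (potential_nonneg u y)

theorem normalizer_pos (hG : Measurable G) (y : EuclideanSpace ℝ ι) :
    0 < normalizer μ0 Γ G y := integral_exp_pos (integrable_likelihood hG y)

theorem measurable_normalizer (hG : Measurable G) : Measurable (normalizer μ0 Γ G) :=
  ((measurable_likelihood hG).stronglyMeasurable.integral_prod_right').measurable

theorem ofReal_normalizer (hG : Measurable G) (y : EuclideanSpace ℝ ι) :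
    ENNReal.ofReal (normalizer μ0 Γ G y) =
      ∫⁻ u, ENNReal.ofReal (Real.exp (-potential Γ G u y)) ∂μ0 :=
  ofReal_integral_eq_lintegral_ofReal (integrable_likelihood hG y)
    (ae_of_all _ fun _ => (Real.exp_pos _).le)

variable (μ0 Γ G) in
/-- The posterior density `exp(-Φ(u; y)) / Z(y)`. -/
noncomputable def posteriorDensity (y : EuclideanSpace ℝ ι) (u : X) : ℝ≥0∞ :=
  ENNReal.ofReal (1 / normalizer μ0 Γ G y * Real.exp (-potential Γ G u y))

theorem measurable_posteriorDensity (hG : Measurable G) :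
    Measurable (Function.uncurry (posteriorDensity μ0 Γ G)) := by
  unfold posteriorDensity Function.uncurry
  exact ((((measurable_normalizer hG).comp measurable_fst).const_div 1).mul
    (measurable_likelihood hG)).ennreal_ofReal

theorem measurable_posteriorDensity_right (hG : Measurable G) (y : EuclideanSpace ℝ ι) :
    Measurable (posteriorDensity μ0 Γ G y) := by
  have h : Measurable fun u : X => (y, u) := measurable_prodMk_left
  have h' := (measurable_posteriorDensity (μ0 := μ0) (Γ := Γ) hG).comp h
  exact h'

theorem ofReal_normalizer_mul_posteriorDensity (hG : Measurable G) (y : EuclideanSpace ℝ ι)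
    (u : X) : ENNReal.ofReal (normalizer μ0 Γ G y) * posteriorDensity μ0 Γ G y u =
      ENNReal.ofReal (Real.exp (-potential Γ G u y)) := by
  have hZ := normalizer_pos (μ0 := μ0) (Γ := Γ) hG y
  rw [posteriorDensity, ← ENNReal.ofReal_mul hZ.le, ← mul_assoc, mul_one_div_cancel hZ.ne', one_mul]

theorem lintegral_posteriorDensity (hG : Measurable G) (y : EuclideanSpace ℝ ι) :
    ∫⁻ u, posteriorDensity μ0 Γ G y u ∂μ0 = 1 := by
  have hZ := normalizer_pos (μ0 := μ0) (Γ := Γ) hG y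
  have h1 : ENNReal.ofReal (normalizer μ0 Γ G y) * ∫⁻ u, posteriorDensity μ0 Γ G y u ∂μ0 =
      ENNReal.ofReal (normalizer μ0 Γ G y) * 1 := by
    rw [← lintegral_const_mul _ (measurable_posteriorDensity_right hG y), mul_one]
    refine Eq.trans ?_ (ofReal_normalizer hG y).symm
    exact lintegral_congr fun u => ofReal_normalizer_mul_posteriorDensity hG y u
  exact (ENNReal.mul_right_inj (ENNReal.ofReal_pos.2 hZ).ne' ENNReal.ofReal_ne_top).1 h1

variable (μ0 Γ G) in
/-- The posterior `μ^y`, with density `exp(-Φ(u; y)) / Z(y)` with respect to the prior. -/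
noncomputable def posteriorKernel : Kernel (EuclideanSpace ℝ ι) X :=
  (Kernel.const _ μ0).withDensity (posteriorDensity μ0 Γ G)

theorem posteriorKernel_apply (hG : Measurable G) (y : EuclideanSpace ℝ ι) :
    posteriorKernel μ0 Γ G y = μ0.withDensity (posteriorDensity μ0 Γ G y) := by
  rw [posteriorKernel, Kernel.withDensity_apply _ (measurable_posteriorDensity hG),
    Kernel.const_apply]

theorem isMarkovKernel_posteriorKernel (hG : Measurable G) :
    IsMarkovKernel (posteriorKernel μ0 Γ G) := by
  refine ⟨fun y => ⟨?_⟩⟩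
  rw [posteriorKernel_apply hG, withDensity_apply _ MeasurableSet.univ, Measure.restrict_univ,
    lintegral_posteriorDensity hG]

/-- Up to a constant, the joint law of `(y, u)` has density `exp(-Φ(u; y))` with respect to the
product of Lebesgue measure and the prior. -/
theorem exists_lintegral_jointLaw (hΓ : Γ.PosDef) (hG : Measurable G) :
    ∃ κ : ℝ≥0∞, ∀ f : EuclideanSpace ℝ ι × X → ℝ≥0∞, Measurable f →
      ∫⁻ p, f p ∂(jointLaw μ0 Γ G) =
        κ * ∫⁻ y, ∫⁻ u, f (y, u) * ENNReal.ofReal (Real.exp (-potential Γ G u y)) ∂μ0 := by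
  obtain ⟨κ, hκ⟩ := exists_lintegral_multivariateGaussian hΓ
  refine ⟨κ, fun f hf => ?_⟩
  have hT : Measurable fun q : X × EuclideanSpace ℝ ι => (G q.1 + q.2, q.1) := by fun_prop
  have hF : Measurable fun p : EuclideanSpace ℝ ι × X =>
      f p * ENNReal.ofReal (Real.exp (-potential Γ G p.2 p.1)) :=
    hf.mul (measurable_likelihood hG).ennreal_ofReal
  rw [jointLaw, lintegral_map hf hT,
    lintegral_prod (fun q : X × EuclideanSpace ℝ ι => f (G q.1 + q.2, q.1))
      (hf.comp hT).aemeasurable]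
  have hinner : ∀ u, ∫⁻ η, f (G u + η, u) ∂(multivariateGaussian 0 Γ) =
      κ * ∫⁻ y, f (y, u) * ENNReal.ofReal (Real.exp (-potential Γ G u y)) := by
    intro u
    have hfu : Measurable fun η => f (G u + η, u) := by fun_prop
    rw [hκ _ hfu]
    congr 1
    rw [← lintegral_add_left_eq_self (μ := (volume : Measure (EuclideanSpace ℝ ι)))
      (fun y => f (y, u) * ENNReal.ofReal (Real.exp (-potential Γ G u y))) (G u)]
    refine lintegral_congr fun η => ?_
    rw [potential, add_sub_cancel_left]
  simp only [hinner]
  rw [lintegral_const_mul, lintegral_lintegral_swap]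
  · exact (hF.comp measurable_swap).aemeasurable
  · exact (hF.comp measurable_swap).lintegral_prod_right'

/-- Bayes' theorem: the posterior is the regular conditional distribution of `u` given `y`. -/
theorem compProd_posteriorKernel (hΓ : Γ.PosDef) (hG : Measurable G) :
    (jointLaw μ0 Γ G).fst ⊗ₘ posteriorKernel μ0 Γ G = jointLaw μ0 Γ G := by
  have := isMarkovKernel_posteriorKernel (μ0 := μ0) (Γ := Γ) hG
  have hprob : IsProbabilityMeasure (jointLaw μ0 Γ G) :=
    Measure.isProbabilityMeasure_map
      (by fun_prop : Measurable fun q : X × EuclideanSpace ℝ ι => (G q.1 + q.2, q.1)).aemeasurable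
  obtain ⟨κ, hκ⟩ := exists_lintegral_jointLaw (μ0 := μ0) hΓ hG
  refine Measure.ext_of_lintegral _ fun f hf => ?_
  have hinner : Measurable fun y => ∫⁻ u, f (y, u) ∂(posteriorKernel μ0 Γ G y) :=
    hf.lintegral_kernel_prod_right'
  rw [Measure.lintegral_compProd hf, Measure.fst, lintegral_map hinner measurable_fst,
    hκ (fun p => ∫⁻ u, f (p.1, u) ∂(posteriorKernel μ0 Γ G p.1)) (hinner.comp measurable_fst),
    hκ _ hf]
  congr 1
  refine lintegral_congr fun y => ?_
  have hpd := measurable_posteriorDensity_right (μ0 := μ0) (Γ := Γ) hG y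
  have hfy : Measurable fun u => f (y, u) := hf.comp measurable_prodMk_left
  simp only
  rw [lintegral_const_mul _ (measurable_likelihood_right hG y).ennreal_ofReal,
    ← ofReal_normalizer hG, posteriorKernel_apply hG,
    lintegral_withDensity_eq_lintegral_mul _ hpd hfy, mul_comm,
    ← lintegral_const_mul _ (hpd.mul hfy)]
  refine lintegral_congr fun u => ?_
  rw [Pi.mul_apply, ← mul_assoc, ofReal_normalizer_mul_posteriorDensity hG, mul_comm]

theorem rnDeriv_posteriorKernel (hG : Measurable G) (y : EuclideanSpace ℝ ι) :
    (posteriorKernel μ0 Γ G y).rnDeriv μ0 =ᵐ[μ0] posteriorDensity μ0 Γ G y := by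
  rw [posteriorKernel_apply hG]
  exact Measure.rnDeriv_withDensity _ (measurable_posteriorDensity_right hG y)

theorem abs_normalizer_sub_le (hG : Measurable G) (y y' : EuclideanSpace ℝ ι) :
    |normalizer μ0 Γ G y - normalizer μ0 Γ G y'| ≤ 2 * weightedNorm Γ (y - y') := by
  rw [normalizer, normalizer, ← integral_sub (integrable_likelihood hG y)
    (integrable_likelihood hG y'), ← Real.norm_eq_abs]
  refine (norm_integral_le_of_norm_le_const (C := 2 * weightedNorm Γ (y - y'))
    (ae_of_all _ fun u => ?_)).trans (by simp)
  have e : ∀ z, Real.exp (-potential Γ G u z) = Real.exp (-(potential Γ G u z / 2)) ^ 2 := by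
    intro z
    rw [← Real.exp_nat_mul]
    congr 1
    push_cast
    ring
  have hle : ∀ z, Real.exp (-(potential Γ G u z / 2)) ≤ 1 := fun z => by
    rw [Real.exp_le_one_iff]
    linarith [potential_nonneg (Γ := Γ) (G := G) u z]
  have h := abs_exp_half_potential_sub_le (Γ := Γ) (G := G) u y y'
  rw [Real.norm_eq_abs, e, e, sq_sub_sq, abs_mul]
  have h2 : |Real.exp (-(potential Γ G u y / 2)) + Real.exp (-(potential Γ G u y' / 2))| ≤ 2 := by
    rw [abs_of_pos (by positivity)]
    linarith [hle y, hle y']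
  exact mul_le_mul h2 h (abs_nonneg _) zero_le_two

/-- A lower bound for `Z(y)` that is uniform for `|y|_Γ < ρ`, from
`|y - G(u)|_Γ² ≤ 2 |y|_Γ² + 2 |G(u)|_Γ²`. No bound on `G` is needed. -/
theorem le_normalizer (hG : Measurable G) {ρ : ℝ} {y : EuclideanSpace ℝ ι}
    (hy : weightedNorm Γ y < ρ) :
    Real.exp (-ρ ^ 2) * ∫ u, Real.exp (-weightedNorm Γ (G u) ^ 2) ∂μ0 ≤ normalizer μ0 Γ G y := by
  rw [← integral_const_mul]
  refine integral_mono_of_nonneg (ae_of_all _ fun u => by positivity) (integrable_likelihood hG y)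
    (ae_of_all _ fun u => ?_)
  simp only
  rw [← Real.exp_add, Real.exp_le_exp, potential]
  have h1 := weightedNorm_sub_le Γ y (G u)
  have h2 := weightedNorm_nonneg Γ y
  have h3 := weightedNorm_nonneg Γ (G u)
  have h4 : weightedNorm Γ (y - G u) ^ 2 ≤ (weightedNorm Γ y + weightedNorm Γ (G u)) ^ 2 :=
    pow_le_pow_left₀ (weightedNorm_nonneg _ _) h1 2
  have h5 : weightedNorm Γ y ^ 2 ≤ ρ ^ 2 := pow_le_pow_left₀ h2 hy.le 2
  nlinarith [sq_nonneg (weightedNorm Γ y - weightedNorm Γ (G u))]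

theorem integral_exp_neg_weightedNorm_pos (hG : Measurable G) :
    0 < ∫ u, Real.exp (-weightedNorm Γ (G u) ^ 2) ∂μ0 := by
  refine integral_exp_pos (Integrable.of_bound ?_ 1 (ae_of_all _ fun u => ?_))
  · have := ((continuous_weightedNorm Γ).measurable.comp hG).pow_const 2
    exact (Real.measurable_exp.comp this.neg).aestronglyMeasurable
  · rw [Real.norm_eq_abs, abs_of_pos (Real.exp_pos _), Real.exp_le_one_iff, neg_nonpos]
    positivity

/-- The pointwise estimate behind the Hellinger bound: `g, g'` stand for square roots of the
likelihoods and `z, z'` for square roots of the normalizers. -/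
theorem sq_div_sub_div_le {g g' z z' r m : ℝ} (hm : 0 < m) (hz : 0 < z) (hz' : 0 < z')
    (hmz : m ≤ z ^ 2) (hmz' : m ≤ z' ^ 2) (hg' : |g'| ≤ 1) (hg : |g - g'| ≤ r)
    (hzz : |z ^ 2 - z' ^ 2| ≤ 2 * r) :
    (g / z - g' / z') ^ 2 ≤ 2 * (1 / m + 1 / m ^ 3) * r ^ 2 := by
  have hr : 0 ≤ r := (abs_nonneg _).trans hg
  have hdecomp : g / z - g' / z' =
      (g - g') / z + g' * ((z' ^ 2 - z ^ 2) / (z * z' * (z + z'))) := by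
    field_simp
    ring
  have h1 : ((g - g') / z) ^ 2 ≤ 1 / m * r ^ 2 := by
    rw [div_pow, div_le_iff₀ (by positivity)]
    have e1 : (g - g') ^ 2 ≤ r ^ 2 := sq_le_sq' (abs_le.1 hg).1 (abs_le.1 hg).2
    have e2 : r ^ 2 ≤ 1 / m * r ^ 2 * z ^ 2 := by
      calc r ^ 2 = 1 / m * r ^ 2 * m := by field_simp
        _ ≤ _ := by gcongr
    exact e1.trans e2
  have h2 : (g' * ((z' ^ 2 - z ^ 2) / (z * z' * (z + z')))) ^ 2 ≤ 1 / m ^ 3 * r ^ 2 := by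
    rw [mul_pow, div_pow, ← sq_abs g']
    have e1 : (z' ^ 2 - z ^ 2) ^ 2 ≤ (2 * r) ^ 2 := by
      refine sq_le_sq' ?_ ?_ <;> linarith [(abs_le.1 hzz).1, (abs_le.1 hzz).2]
    have e3 : 4 * m ≤ (z + z') ^ 2 := by
      have : z ^ 2 * z' ^ 2 ≥ m ^ 2 := by rw [sq m]; gcongr
      have e4 : m ≤ z * z' := by
        refine le_of_sq_le_sq ?_ (by positivity)
        rw [mul_pow]; exact this
      nlinarith
    have e5 : 4 * m ^ 3 ≤ (z * z' * (z + z')) ^ 2 := by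
      rw [mul_pow, mul_pow]
      calc 4 * m ^ 3 = m * m * (4 * m) := by ring
        _ ≤ _ := by gcongr
    calc |g'| ^ 2 * ((z' ^ 2 - z ^ 2) ^ 2 / (z * z' * (z + z')) ^ 2)
        ≤ 1 ^ 2 * ((2 * r) ^ 2 / (4 * m ^ 3)) := by gcongr
      _ = 1 / m ^ 3 * r ^ 2 := by field_simp; ring
  rw [hdecomp]
  calc ((g - g') / z + g' * ((z' ^ 2 - z ^ 2) / (z * z' * (z + z')))) ^ 2
      ≤ 2 * (((g - g') / z) ^ 2 + (g' * ((z' ^ 2 - z ^ 2) / (z * z' * (z + z')))) ^ 2) :=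
        add_sq_le
    _ ≤ 2 * (1 / m * r ^ 2 + 1 / m ^ 3 * r ^ 2) := by gcongr
    _ = _ := by ring

/-- The posterior is locally Lipschitz in the data, in the Hellinger distance. -/
theorem exists_hellingerDist_posteriorKernel_le (hG : Measurable G) :
    ∃ C : ℝ → ℝ, ∀ (ρ : ℝ) (y y' : EuclideanSpace ℝ ι), weightedNorm Γ y < ρ →
      weightedNorm Γ y' < ρ →
        hellingerDist μ0 (posteriorKernel μ0 Γ G y) (posteriorKernel μ0 Γ G y') ≤
          C ρ * weightedNorm Γ (y - y') := by
  set I := ∫ u, Real.exp (-weightedNorm Γ (G u) ^ 2) ∂μ0 with hI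
  have hIpos : 0 < I := integral_exp_neg_weightedNorm_pos hG
  set m : ℝ → ℝ := fun ρ => Real.exp (-ρ ^ 2) * I with hm
  refine ⟨fun ρ => √(1 / m ρ + 1 / m ρ ^ 3), fun ρ y y' hy hy' => ?_⟩
  have hmpos : 0 < m ρ := by positivity
  set r := weightedNorm Γ (y - y') with hr
  have hr0 : 0 ≤ r := weightedNorm_nonneg _ _
  have hZ : ∀ z, 0 < normalizer μ0 Γ G z := fun z => normalizer_pos hG z
  have hsqrt : ∀ (z : EuclideanSpace ℝ ι) (u : X), √(posteriorDensity μ0 Γ G z u).toReal =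
      Real.exp (-(potential Γ G u z / 2)) / √(normalizer μ0 Γ G z) := by
    intro z u
    have hnn : 0 ≤ 1 / normalizer μ0 Γ G z * Real.exp (-potential Γ G u z) := by
      have := hZ z
      positivity
    rw [posteriorDensity, ENNReal.toReal_ofReal hnn, one_div_mul_eq_div,
      Real.sqrt_div (Real.exp_pos _).le, ← Real.exp_half, neg_div]
  have hpt : ∀ᵐ u ∂μ0, (√((posteriorKernel μ0 Γ G y).rnDeriv μ0 u).toReal -
      √((posteriorKernel μ0 Γ G y').rnDeriv μ0 u).toReal) ^ 2 ≤
        2 * (1 / m ρ + 1 / m ρ ^ 3) * r ^ 2 := by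
    filter_upwards [rnDeriv_posteriorKernel (μ0 := μ0) (Γ := Γ) hG y,
      rnDeriv_posteriorKernel (μ0 := μ0) (Γ := Γ) hG y'] with u h1 h2
    rw [h1, h2, hsqrt, hsqrt]
    refine sq_div_sub_div_le hmpos (Real.sqrt_pos.2 (hZ y)) (Real.sqrt_pos.2 (hZ y')) ?_ ?_ ?_
      (abs_exp_half_potential_sub_le u y y') ?_
    · rw [Real.sq_sqrt (hZ y).le]
      exact le_normalizer hG hy
    · rw [Real.sq_sqrt (hZ y').le]
      exact le_normalizer hG hy'
    · rw [abs_of_pos (Real.exp_pos _), Real.exp_le_one_iff]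
      linarith [potential_nonneg (Γ := Γ) (G := G) u y']
    · rw [Real.sq_sqrt (hZ y).le, Real.sq_sqrt (hZ y').le]
      exact abs_normalizer_sub_le hG y y'
  have hint : ∫ u, (√((posteriorKernel μ0 Γ G y).rnDeriv μ0 u).toReal -
      √((posteriorKernel μ0 Γ G y').rnDeriv μ0 u).toReal) ^ 2 ∂μ0 ≤
        2 * (1 / m ρ + 1 / m ρ ^ 3) * r ^ 2 := by
    refine (integral_mono_of_nonneg (ae_of_all _ fun u => sq_nonneg _)
      (integrable_const (2 * (1 / m ρ + 1 / m ρ ^ 3) * r ^ 2)) hpt).trans ?_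
    simp
  rw [hellingerDist]
  calc √((1 / 2 : ℝ) * ∫ u, (√((posteriorKernel μ0 Γ G y).rnDeriv μ0 u).toReal -
      √((posteriorKernel μ0 Γ G y').rnDeriv μ0 u).toReal) ^ 2 ∂μ0)
      ≤ √((1 / m ρ + 1 / m ρ ^ 3) * r ^ 2) := by
        refine Real.sqrt_le_sqrt ?_
        linarith
    _ = √(1 / m ρ + 1 / m ρ ^ 3) * r := by
        rw [Real.sqrt_mul (by positivity), Real.sqrt_sq hr0]

end Bayes

end LevelSetBayes

theorem theorem5p2
    -- the bounded Lipschitz domain and the boundary elements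
    (Ω : Set Plane) (hΩ : IsLipschitzDomain Ω)
    (L : ℕ) (O : Fin L → Set Plane) (hO_sub : ∀ l, O l ⊆ frontier Ω)
    (hO_meas : ∀ l, MeasurableSet (O l)) (hO_pos : ∀ l, 0 < surfaceMeasure Ω (O l))
    -- the flux patterns
    (J : ℕ) (F : Fin J → EuclideanSpace ℝ (Fin L))
    -- thresholds and values of the two piecewise constant coefficients
    (M : ℕ) (c : Fin (M + 1) → EReal) (hc : StrictMono c) (hc_first : c 0 = ⊥)
    (hc_last : c (Fin.last M) = ⊤) (a : Fin M → ℝ) (ha : ∀ i, 0 < a i)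
    (N : ℕ) (d : Fin (N + 1) → EReal) (hd : StrictMono d) (hd_first : d 0 = ⊥)
    (hd_last : d (Fin.last N) = ⊤) (b : Fin N → ℝ) (hb : ∀ i, 0 < b i)
    -- the covariance of the noise of one measurement
    (Γ₀ : Matrix (Fin L) (Fin L) ℝ) (hΓ₀ : Γ₀.PosDef)
    -- the two Gaussian priors on `C(closure Ω)` with its Borel sigma-algebra
    [MeasurableSpace C(closure Ω, ℝ)] [BorelSpace C(closure Ω, ℝ)]
    (μ₁ μ₂ : Measure C(closure Ω, ℝ)) [IsGaussian μ₁] [IsGaussian μ₂] :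
    -- the forward map is well defined: the elliptic model is uniquely solvable
    (∀ (u₁ u₂ : C(closure Ω, ℝ)) (j : Fin J),
      ∃! p, IsWeakSolution Ω O (levelSetMap c a u₁) (levelSetMap d b u₂) (F j) p) ∧
    Measurable (forwardMap Ω O F c a d b) ∧
    -- the posterior exists as the conditional law of `(u₁, u₂)` given `y`
    ∃ post : Kernel (Data L J) (C(closure Ω, ℝ) × C(closure Ω, ℝ)),
      IsMarkovKernel post ∧
      (jointLaw (μ₁.prod μ₂) (noiseCov J Γ₀) (forwardMap Ω O F c a d b)).fst ⊗ₘ post =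
        jointLaw (μ₁.prod μ₂) (noiseCov J Γ₀) (forwardMap Ω O F c a d b) ∧
      -- its density with respect to the prior
      (∀ y : Data L J,
        0 < normalizer (μ₁.prod μ₂) (noiseCov J Γ₀) (forwardMap Ω O F c a d b) y ∧
        post y ≪ μ₁.prod μ₂ ∧
        (post y).rnDeriv (μ₁.prod μ₂) =ᵐ[μ₁.prod μ₂] fun u =>
          ENNReal.ofReal
            (1 / normalizer (μ₁.prod μ₂) (noiseCov J Γ₀) (forwardMap Ω O F c a d b) y *
              Real.exp (-potential (noiseCov J Γ₀) (forwardMap Ω O F c a d b) u y))) ∧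
      -- local Lipschitz continuity in the data
      ∃ C : ℝ → ℝ, ∀ (ρ : ℝ) (y y' : Data L J),
        weightedNorm (noiseCov J Γ₀) y < ρ → weightedNorm (noiseCov J Γ₀) y' < ρ →
          hellingerDist (μ₁.prod μ₂) (post y) (post y') ≤
            C ρ * weightedNorm (noiseCov J Γ₀) (y - y') := by
  have hG : Measurable (forwardMap Ω O F c a d b) :=
    measurable_forwardMap hΩ hO_meas hO_pos F hc hc_first hc_last ha hd hd_first hd_last hb
  have hΓ := posDef_noiseCov J hΓ₀
  refine ⟨fun u₁ u₂ j => existsUnique_isWeakSolution_levelSetMap hΩ hO_meas hO_pos (F j)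
      hc hc_first hc_last ha hd hd_first hd_last hb u₁ u₂, hG,
    posteriorKernel (μ₁.prod μ₂) (noiseCov J Γ₀) (forwardMap Ω O F c a d b),
    isMarkovKernel_posteriorKernel hG, compProd_posteriorKernel hΓ hG,
    fun y => ⟨normalizer_pos hG y, ?_, rnDeriv_posteriorKernel hG y⟩,
    exists_hellingerDist_posteriorKernel_le hG⟩
  rw [posteriorKernel_apply hG]
  exact withDensity_absolutelyContinuous _ _
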